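/- Let $N$ be one of the three-dimensional space forms: Euclidean space $\mathbb{R}^3$ with its dot product; for $\kappa>0$ the sphere $\{x\in\mathbb{R}^4 : x\cdot x=1/\kappa\}$, where $\cdot$ is the Euclidean inner product; or, for $\kappa<0$, the hyperbolic space $\{x\in\mathbb{R}^{1,3} : x\cdot x=1/\kappa,\ x_0>0\}$, where $x\cdot y=-x_0y_0+x_1y_1+x_2y_2+x_3y_3$. Let $M$ be a compact connected smooth surface without boundary and let $\vec r:M\to N$ be a smooth immersion which is (strictly) convex, that is, there is a smooth unit normal field $\nu$ of $\vec r$ in $N$ for which the second fundamental form $h(v,w)=d\nu(v)\cdot d\vec r(w)$ is positive definite at every point of $M$. Then $\vec r$ is infinitesimally rigid: a smooth vector field $\tau$ of $N$ along $\vec r$ (so $\tau(p)\in T_{\vec r(p)}N$ for all $p\in M$) satisfies the linearized isometric embedding equation $d\vec r\cdot d\tau=0$, that is, $$d\vec r(v)\cdot d\tau(w)+d\vec r(w)\cdot d\tau(v)=0\qquad\text{for all } p\in M,\ v,w\in T_pM,$$ if and only if it comes from the Lie algebra of the isometry group of $N$, that is, there is a one-parameter group $(\varphi_t)_{t\in\mathbb{R}}$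 of isometries of $N$, with $t\mapsto\varphi_t(x)$ differentiable at $t=0$ for every $x\in N$, such that $\tau(p)=\frac{d}{dt}\big|_{t=0}\varphi_t(\vec r(p))$ for all $p\in M$. -/

import Mathlib

open scoped Manifold ContDiff RealInnerProductSpace

noncomputable section

/-- A hypersurface model of a space: a subset `carrier` of a vector space `V`, its tangent
spaces as subspaces of `V`, and an ambient bilinear form on `V` whose restriction to the tangent
spaces is the metric of the space.  Only the three models below are ever used: `euclideanModel`,
`sphericalModel κ` and `hyperbolicModel κ`. -/
structure AmbientModel (V : Type*) [NormedAddCommGroup V] [NormedSpace ℝ V] where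
  /-- the ambient bilinear form, written as a dot -/
  form : V →L[ℝ] V →L[ℝ] ℝ
  /-- the points of the space -/
  carrier : Set V
  /-- the tangent space at a point, as a subspace of `V` -/
  tangent : V → Submodule ℝ V

/-- Euclidean three-space. -/
def euclideanModel : AmbientModel (EuclideanSpace ℝ (Fin 3)) where
  form := innerSL ℝ
  carrier := Set.univ
  tangent := fun _ => ⊤

/-- The round three-sphere of constant sectional curvature `κ > 0`: the sphere of radius `1 / √κ`
about the origin of Euclidean four-space. -/
def sphericalModel (κ : ℝ) : AmbientModel (EuclideanSpace ℝ (Fin 4)) where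
  form := innerSL ℝ
  carrier := {x | ⟪x, x⟫ = 1 / κ}
  tangent := fun x => LinearMap.ker (innerSL ℝ x).toLinearMap

/-- The bilinear form `(x, y) ↦ xᵢyᵢ` on four-space. -/
def coordForm (i : Fin 4) : EuclideanSpace ℝ (Fin 4) →L[ℝ] EuclideanSpace ℝ (Fin 4) →L[ℝ] ℝ :=
  (EuclideanSpace.proj (𝕜 := ℝ) i).smulRight (EuclideanSpace.proj (𝕜 := ℝ) i)

/-- The Minkowski form `-x₀y₀ + x₁y₁ + x₂y₂ + x₃y₃` on four-space. -/
def minkowskiForm : EuclideanSpace ℝ (Fin 4) →L[ℝ] EuclideanSpace ℝ (Fin 4) →L[ℝ] ℝ :=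
  -coordForm 0 + coordForm 1 + coordForm 2 + coordForm 3

theorem minkowskiForm_apply (x y : EuclideanSpace ℝ (Fin 4)) :
    minkowskiForm x y = -(x 0 * y 0) + x 1 * y 1 + x 2 * y 2 + x 3 * y 3 := by
  simp [minkowskiForm, coordForm]

/-- Hyperbolic three-space of constant sectional curvature `κ < 0`: the upper sheet of the
hyperboloid `x · x = 1 / κ` in Minkowski space. -/
def hyperbolicModel (κ : ℝ) : AmbientModel (EuclideanSpace ℝ (Fin 4)) where
  form := minkowskiForm
  carrier := {x | minkowskiForm x x = 1 / κ ∧ 0 < x 0}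
  tangent := fun x => LinearMap.ker (minkowskiForm x).toLinearMap

namespace AmbientModel

variable {V : Type*} [NormedAddCommGroup V] [NormedSpace ℝ V] (S : AmbientModel V)

/-- The isometry group of the space.  In each of the three models the geodesic distance of two
points is a strictly increasing function of `(x - y) · (x - y)`, so the isometries are the
bijections of the space that preserve this quantity. -/
def isometryGroup : Subgroup (Equiv.Perm S.carrier) where
  carrier := {g | ∀ x y : S.carrier,
    S.form ((g x : V) - g y) ((g x : V) - g y) = S.form ((x : V) - y) ((x : V) - y)}
  mul_mem' := by
    intro a b ha hb x y
    exact (ha (b x) (b y)).trans (hb x y)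
  one_mem' := by
    intro x y
    rfl
  inv_mem' := by
    intro a ha x y
    have h := ha (a⁻¹ x) (a⁻¹ y)
    rw [show a (a⁻¹ x) = x from a.apply_symm_apply x,
      show a (a⁻¹ y) = y from a.apply_symm_apply y] at h
    exact h.symm

/-- The Lie algebra of the isometry group, each element being written as the vector field that it
induces on the space: the velocity field at time zero of a one-parameter group of isometries. -/
def isometryLieAlgebra : Set (S.carrier → V) :=
  {X | ∃ φ : ℝ → S.isometryGroup, (∀ s t, φ (s + t) = φ s * φ t) ∧
    ∀ x : S.carrier, HasDerivAt (fun t => (((φ t : Equiv.Perm S.carrier) x : S.carrier) : V))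
      (X x) 0}

variable {M : Type*} [TopologicalSpace M] [ChartedSpace (EuclideanSpace ℝ (Fin 2)) M]

/-- The position vector in `V` of a map into the space. -/
def position (r : M → S.carrier) : M → V := fun p => (r p : V)

/-- A smooth unit normal field of the surface `r` in the space. -/
structure IsUnitNormal (r : M → S.carrier) (ν : M → V) : Prop where
  smooth : ContMDiff (𝓡 2) 𝓘(ℝ, V) ∞ ν
  tangent : ∀ p, ν p ∈ S.tangent (r p)
  normal : ∀ p, ∀ v : TangentSpace (𝓡 2) p, S.form (ν p) (mvfderiv (𝓡 2) (S.position r) p v) = 0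
  unit : ∀ p, S.form (ν p) (ν p) = 1

/-- The second fundamental form `h(v, w) = D_v ν · dr(w)` with respect to the unit normal `ν`
(the sign for which round spheres have `h > 0` when `ν` is the outer normal).  The Levi-Civita
derivative `D_v ν` is the part of `dν(v)` tangent to the space; as `dr(w)` is tangent to the
space, `D_v ν · dr(w) = dν(v) · dr(w)`. -/
def secondFundamentalForm (r : M → S.carrier) (ν : M → V) (p : M)
    (v w : TangentSpace (𝓡 2) p) : ℝ :=
  S.form (mvfderiv (𝓡 2) ν p v) (mvfderiv (𝓡 2) (S.position r) p w)

/-- `r` is a smooth immersed surface in the space which is (strictly) convex: its second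
fundamental form with respect to a suitable unit normal is positive definite at every point. -/
structure IsConvexSurface (r : M → S.carrier) : Prop where
  smooth : ContMDiff (𝓡 2) 𝓘(ℝ, V) ∞ (S.position r)
  immersion : ∀ p, Function.Injective (mvfderiv (𝓡 2) (S.position r) p)
  convex : ∃ ν : M → V, S.IsUnitNormal r ν ∧
    ∀ p, ∀ v : TangentSpace (𝓡 2) p, v ≠ 0 → 0 < S.secondFundamentalForm r ν p v v

/-- A smooth vector field of the space along the surface `r`. -/
structure IsVectorFieldAlong (r : M → S.carrier) (τ : M → V) : Prop where
  smooth : ContMDiff (𝓡 2) 𝓘(ℝ, V) ∞ τ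
  tangent : ∀ p, τ p ∈ S.tangent (r p)

/-- The linearized isometric embedding equation `dr · dτ = 0`, an equation between symmetric
two-tensors on the surface.  As `dr` is tangent to the space, `dr · dτ = dr · Dτ` with the
Levi-Civita derivative `D` of the space. -/
def SolvesLinearized (r : M → S.carrier) (τ : M → V) : Prop :=
  ∀ p, ∀ v w : TangentSpace (𝓡 2) p,
    S.form (mvfderiv (𝓡 2) (S.position r) p v) (mvfderiv (𝓡 2) τ p w)
      + S.form (mvfderiv (𝓡 2) (S.position r) p w) (mvfderiv (𝓡 2) τ p v) = 0

/-- Infinitesimal rigidity: the solutions of the linearized equation are exactly the restrictions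
to the surface of the elements of the Lie algebra of the isometry group. -/
def IsInfinitesimallyRigid (r : M → S.carrier) : Prop :=
  ∀ τ : M → V, S.IsVectorFieldAlong r τ →
    (S.SolvesLinearized r τ ↔ ∃ X ∈ S.isometryLieAlgebra, ∀ p, τ p = X (r p))

end AmbientModel

end

open Filter Topology Metric

/-- The plane in which the charts of a surface take their values. -/
local notation "ℝ²" => EuclideanSpace ℝ (Fin 2)

theorem IsLocalMax.snd_fderiv_nonpos {E : Type*} [NormedAddCommGroup E] [NormedSpace ℝ E]
    {w : E → ℝ} {x : E} (hw : ContDiffAt ℝ 2 w x) (hmax : IsLocalMax w x) (v : E) :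
    fderiv ℝ (fderiv ℝ w) x v v ≤ 0 := by
  by_contra! hpos
  have hline : ∀ t : ℝ, HasDerivAt (fun t : ℝ => x + t • v) v t := fun t => by
    simpa using ((hasDerivAt_id t).smul_const v).const_add x
  have hcont : ContinuousAt (fun t : ℝ => x + t • v) 0 := (hline 0).continuousAt
  have hx0 : x + (0 : ℝ) • v = x := by simp
  have hdiff : ∀ᶠ y in 𝓝 x, DifferentiableAt ℝ w y :=
    (hw.eventually (by simp)).mono fun y hy => hy.differentiableAt (by simp)
  have hev : ∀ᶠ t in 𝓝 (0 : ℝ), DifferentiableAt ℝ w (x + t • v) :=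
    hcont.eventually (by simpa using hdiff)
  set g : ℝ → ℝ := fun t => w (x + t • v) with hg
  have hg1 : deriv g =ᶠ[𝓝 0] fun t => fderiv ℝ w (x + t • v) v := by
    filter_upwards [hev] with t ht
    exact (ht.hasFDerivAt.comp_hasDerivAt t (hline t)).deriv
  have hD : DifferentiableAt ℝ (fderiv ℝ w) x :=
    (hw.fderiv_right (m := 1) (by norm_num)).differentiableAt (by simp)
  have hg2 : HasDerivAt (fun t : ℝ => fderiv ℝ w (x + t • v) v)
      (fderiv ℝ (fderiv ℝ w) x v v) 0 := by
    have h1 : HasDerivAt (fun t : ℝ => fderiv ℝ w (x + t • v))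
        (fderiv ℝ (fderiv ℝ w) x v) 0 := by
      have := hD.hasFDerivAt
      rw [← hx0] at this
      have h := this.comp_hasDerivAt (0 : ℝ) (hline 0)
      rw [hx0] at h
      exact h
    simpa using h1.clm_apply (hasDerivAt_const (0 : ℝ) v)
  have hgmax : IsLocalMax g 0 := by
    have := hcont.eventually (p := fun y => w y ≤ w x)
      (by simpa [IsLocalMax, IsMaxFilter] using hmax)
    filter_upwards [this] with t ht
    simpa [hg] using ht
  have hdd : deriv (deriv g) 0 = fderiv ℝ (fderiv ℝ w) x v v := by
    rw [hg1.deriv_eq]; exact hg2.deriv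
  have hgc : ContinuousAt g 0 :=
    (hev.self_of_nhds.hasFDerivAt.comp_hasDerivAt (0 : ℝ) (hline 0)).continuousAt
  have hgmin : IsLocalMin g 0 :=
    isLocalMin_of_deriv_deriv_pos (by rw [hdd]; exact hpos) hgmax.deriv_eq_zero hgc
  have hconst : g =ᶠ[𝓝 0] fun _ => g 0 := by
    filter_upwards [hgmax, hgmin] with t h1 h2
    exact le_antisymm h1 h2
  have h3 : deriv g =ᶠ[𝓝 0] fun _ => 0 := by
    simpa using hconst.deriv
  have h4 : deriv (deriv g) 0 = 0 := by rw [h3.deriv_eq]; simp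
  linarith

/-- The second order operator `a₁₁∂₁∂₁ + 2a₁₂∂₁∂₂ + a₂₂∂₂∂₂` at a point of the plane. -/
noncomputable def planeOperator (a b c : ℝ) (B : ℝ² →L[ℝ] ℝ² →L[ℝ] ℝ) : ℝ :=
  a * B (EuclideanSpace.single 0 1) (EuclideanSpace.single 0 1)
    + 2 * b * B (EuclideanSpace.single 0 1) (EuclideanSpace.single 1 1)
    + c * B (EuclideanSpace.single 1 1) (EuclideanSpace.single 1 1)

theorem planeOperator_add (a b c : ℝ) (B B' : ℝ² →L[ℝ] ℝ² →L[ℝ] ℝ) :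
    planeOperator a b c (B + B') = planeOperator a b c B + planeOperator a b c B' := by
  simp [planeOperator]; ring

theorem planeOperator_smul (a b c k : ℝ) (B : ℝ² →L[ℝ] ℝ² →L[ℝ] ℝ) :
    planeOperator a b c (k • B) = k * planeOperator a b c B := by
  simp [planeOperator]; ring

theorem planeOperator_nonpos {a b c lam : ℝ} (hlam : 0 < lam)
    (hell : ∀ ξ η : ℝ, lam * (ξ ^ 2 + η ^ 2) ≤ a * ξ ^ 2 + 2 * b * (ξ * η) + c * η ^ 2)
    {B : ℝ² →L[ℝ] ℝ² →L[ℝ] ℝ} (hB : ∀ v w, B v w = B w v) (hneg : ∀ v, B v v ≤ 0) :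
    planeOperator a b c B ≤ 0 := by
  have ha : 0 < a := by have := hell 1 0; norm_num at this; linarith
  have hdet : 0 ≤ a * c - b ^ 2 := by
    have h := hell (-b) a
    have : 0 ≤ a * (a * c - b ^ 2) := by
      have h0 : 0 ≤ lam * ((-b) ^ 2 + a ^ 2) := by positivity
      nlinarith
    exact nonneg_of_mul_nonneg_right this ha
  have h1 := hneg (a • EuclideanSpace.single 0 1 + b • EuclideanSpace.single 1 1)
  have h2 := hneg (EuclideanSpace.single 1 1)
  have h3 := hB (EuclideanSpace.single 1 1) (EuclideanSpace.single 0 1)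
  simp only [map_add, map_smul, add_apply, smul_apply,
    smul_eq_mul, h3] at h1
  have h4 : a * planeOperator a b c B ≤ 0 := by
    unfold planeOperator
    nlinarith [mul_nonneg hdet (neg_nonneg.2 h2)]
  exact nonpos_of_mul_nonpos_right h4 ha

section Barrier

variable (α : ℝ) (z : ℝ²)

/-- The Gaussian barrier of Hopf's maximum principle. -/
noncomputable def gaussianBarrier (x : ℝ²) : ℝ := Real.exp (-α * ‖x - z‖ ^ 2)

theorem contDiff_gaussianBarrier : ContDiff ℝ ∞ (gaussianBarrier α z) := by
  unfold gaussianBarrier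
  exact Real.contDiff_exp.comp (contDiff_const.mul ((contDiff_id.sub contDiff_const).norm_sq ℝ))

theorem hasFDerivAt_gaussianBarrier (x : ℝ²) :
    HasFDerivAt (gaussianBarrier α z)
      ((-2 * α * gaussianBarrier α z x) • innerSL ℝ (x - z)) x := by
  have h1 : HasFDerivAt (fun y : ℝ² => ‖y - z‖ ^ 2) ((2 : ℝ) • innerSL ℝ (x - z)) x := by
    have := ((hasFDerivAt_id x).sub_const z).norm_sq
    refine this.congr_fderiv ?_
    ext v; simp [two_mul]
  refine ((h1.const_mul (-α)).exp).congr_fderiv ?_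
  ext v
  simp [gaussianBarrier]; ring

theorem fderiv_gaussianBarrier :
    fderiv ℝ (gaussianBarrier α z) =
      fun x => (-2 * α * gaussianBarrier α z x) • innerSL ℝ (x - z) :=
  funext fun x => (hasFDerivAt_gaussianBarrier α z x).fderiv

theorem snd_fderiv_gaussianBarrier (x v w : ℝ²) :
    fderiv ℝ (fderiv ℝ (gaussianBarrier α z)) x v w =
      gaussianBarrier α z x * (4 * α ^ 2 * (⟪x - z, v⟫ * ⟪x - z, w⟫) - 2 * α * ⟪v, w⟫) := by
  rw [fderiv_gaussianBarrier]
  have h1 : HasFDerivAt (fun x => -2 * α * gaussianBarrier α z x)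
      ((-2 * α) • ((-2 * α * gaussianBarrier α z x) • innerSL ℝ (x - z))) x :=
    (hasFDerivAt_gaussianBarrier α z x).const_mul _
  have h2 : HasFDerivAt (fun y : ℝ² => innerSL ℝ (y - z)) (innerSL ℝ) x :=
    (innerSL ℝ (E := ℝ²)).hasFDerivAt.comp x ((hasFDerivAt_id x).sub_const z)
  rw [HasFDerivAt.fderiv (h1.fun_smul h2)]
  simp only [add_apply, smul_apply, ContinuousLinearMap.smulRight_apply, innerSL_apply_apply,
    smul_eq_mul, show (innerSL ℝ) v w = ⟪v, w⟫ from rfl]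
  ring

theorem planeOperator_gaussianBarrier (a b c : ℝ) (x : ℝ²) :
    planeOperator a b c (fderiv ℝ (fderiv ℝ (gaussianBarrier α z)) x) =
      gaussianBarrier α z x * (4 * α ^ 2 * (a * (x - z) 0 ^ 2 + 2 * b * ((x - z) 0 * (x - z) 1)
        + c * (x - z) 1 ^ 2) - 2 * α * (a + c)) := by
  simp only [planeOperator, snd_fderiv_gaussianBarrier]
  simp [EuclideanSpace.inner_single_right]
  ring

end Barrier

/-- The differential inequality that rules out an interior maximum of `u + ε ψ` for the Gaussian
barrier `ψ`. -/
theorem not_isLocalMax_add_gaussianBarrier {u : ℝ² → ℝ} {x z : ℝ²} {a b c lam Lam C α ε m M : ℝ}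
    (hlam : 0 < lam) (hu : ContDiffAt ℝ 2 u x)
    (hell : ∀ ξ η : ℝ, lam * (ξ ^ 2 + η ^ 2) ≤ a * ξ ^ 2 + 2 * b * (ξ * η) + c * η ^ 2)
    (hLam : a + c ≤ Lam) (hC0 : 0 ≤ C)
    (hC : |planeOperator a b c (fderiv ℝ (fderiv ℝ u) x)| ≤ C * ‖fderiv ℝ u x‖)
    (hε : 0 < ε) (hα : 0 < α) (hm : 0 < m) (hmx : m ≤ ‖x - z‖) (hxM : ‖x - z‖ ≤ M)
    (hαbig : Lam + C * M < 2 * α * lam * m ^ 2) :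
    ¬ IsLocalMax (fun y => u y + ε * gaussianBarrier α z y) x := by
  intro hmax
  set ψ := gaussianBarrier α z with hψ
  have hψc : ContDiff ℝ ∞ ψ := contDiff_gaussianBarrier α z
  have hψ2 : ContDiffAt ℝ 2 ψ x := hψc.contDiffAt.of_le (by norm_cast)
  have hψd : ∀ y, DifferentiableAt ℝ ψ y := fun y => hψc.contDiffAt.differentiableAt (by simp)
  have hψpos : 0 < ψ x := Real.exp_pos _
  have hw : ContDiffAt ℝ 2 (fun y => u y + ε * ψ y) x := hu.add (contDiffAt_const.mul hψ2)
  have hD : fderiv ℝ (fun y => u y + ε * ψ y) =ᶠ[𝓝 x]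
      fun y => fderiv ℝ u y + ε • fderiv ℝ ψ y := by
    filter_upwards [hu.eventually (by simp)] with y hy
    have h1 := (hy.differentiableAt (by simp)).hasFDerivAt
    exact (h1.add ((hψd y).hasFDerivAt.const_mul ε)).fderiv
  have h1 : fderiv ℝ u x = -(ε • fderiv ℝ ψ x) := by
    have h := hmax.fderiv_eq_zero
    rw [hD.eq_of_nhds] at h
    exact eq_neg_of_add_eq_zero_left h
  have hu1 : DifferentiableAt ℝ (fderiv ℝ u) x :=
    (hu.fderiv_right (m := 1) (by norm_num)).differentiableAt (by simp)
  have hψ1 : DifferentiableAt ℝ (fderiv ℝ ψ) x :=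
    (hψ2.fderiv_right (m := 1) (by norm_num)).differentiableAt (by simp)
  have h2 : fderiv ℝ (fderiv ℝ (fun y => u y + ε * ψ y)) x =
      fderiv ℝ (fderiv ℝ u) x + ε • fderiv ℝ (fderiv ℝ ψ) x := by
    rw [hD.fderiv_eq]
    exact (hu1.hasFDerivAt.add (hψ1.hasFDerivAt.const_smul ε)).fderiv
  have hsym : ∀ v w, fderiv ℝ (fderiv ℝ (fun y => u y + ε * ψ y)) x v w =
      fderiv ℝ (fderiv ℝ (fun y => u y + ε * ψ y)) x w v := fun v w =>
    (hw.isSymmSndFDerivAt (by simp)).eq v w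
  have h3 := planeOperator_nonpos hlam hell hsym (hmax.snd_fderiv_nonpos hw)
  rw [h2, planeOperator_add, planeOperator_smul, hψ, planeOperator_gaussianBarrier, ← hψ] at h3
  have hnorm : ‖x - z‖ ^ 2 = (x - z) 0 ^ 2 + (x - z) 1 ^ 2 := by
    rw [EuclideanSpace.norm_sq_eq]; simp
  have h4 := hell ((x - z) 0) ((x - z) 1)
  rw [← hnorm] at h4
  have h5 : ‖fderiv ℝ u x‖ = ε * (2 * α * ψ x * ‖x - z‖) := by
    rw [h1, norm_neg, norm_smul, hψ, fderiv_gaussianBarrier, norm_smul, innerSL_apply_norm, ← hψ]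
    simp only [Real.norm_eq_abs, abs_mul, abs_neg, abs_of_pos hε, abs_of_pos hα, abs_of_pos hψpos]
    norm_num
  rw [h5] at hC
  have h6 := neg_abs_le (planeOperator a b c (fderiv ℝ (fderiv ℝ u) x))
  set Q := a * (x - z) 0 ^ 2 + 2 * b * ((x - z) 0 * (x - z) 1) + c * (x - z) 1 ^ 2
  set y := ‖x - z‖
  have h7 : ε * (2 * α * ψ x) * (2 * α * Q - (a + c) - C * y) ≤ 0 := by
    have : ε * (2 * α * ψ x) * (2 * α * Q - (a + c) - C * y) =
      ε * (ψ x * (4 * α ^ 2 * Q - 2 * α * (a + c))) - C * (ε * (2 * α * ψ x * y)) := by ring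
    rw [this]; linarith
  have h8 : 2 * α * Q - (a + c) - C * y ≤ 0 :=
    nonpos_of_mul_nonpos_right h7 (by positivity)
  have h9 : lam * m ^ 2 ≤ Q := le_trans (by gcongr) h4
  have h10 : C * y ≤ C * M := by gcongr
  have h11 : 2 * α * (lam * m ^ 2) ≤ 2 * α * Q := by gcongr
  linarith

/-- Hopf's strong maximum principle in the plane, for a function whose image under an elliptic
second order operator is controlled by its gradient. -/
theorem strong_maximum_principle {u : ℝ² → ℝ} {x₀ : ℝ²} {ρ : ℝ} (hρ : 0 < ρ) {a b c : ℝ² → ℝ}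
    {lam Lam C : ℝ} (hlam : 0 < lam) (hC0 : 0 ≤ C)
    (hu : ∀ x ∈ ball x₀ ρ, ContDiffAt ℝ 2 u x)
    (hell : ∀ x ∈ ball x₀ ρ, ∀ ξ η : ℝ,
      lam * (ξ ^ 2 + η ^ 2) ≤ a x * ξ ^ 2 + 2 * b x * (ξ * η) + c x * η ^ 2)
    (hLam : ∀ x ∈ ball x₀ ρ, a x + c x ≤ Lam)
    (hC : ∀ x ∈ ball x₀ ρ,
      |planeOperator (a x) (b x) (c x) (fderiv ℝ (fderiv ℝ u) x)| ≤ C * ‖fderiv ℝ u x‖)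
    (hmax : ∀ x ∈ ball x₀ ρ, u x ≤ u x₀) : ∀ᶠ x in 𝓝 x₀, u x = u x₀ := by
  have hcont : ∀ x ∈ ball x₀ ρ, ContinuousAt u x := fun x hx => (hu x hx).continuousAt
  filter_upwards [ball_mem_nhds x₀ (show 0 < ρ / 4 by positivity)] with q₀ hq₀
  by_contra hne
  -- the contact set inside a closed ball
  set F : Set ℝ² := closedBall x₀ (ρ / 2) ∩ u ⁻¹' {u x₀} with hF
  have hcontB : ContinuousOn u (closedBall x₀ (ρ / 2)) := fun x hx =>
    (hcont x (closedBall_subset_ball (by linarith) hx)).continuousWithinAt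
  have hFcl : IsClosed F := hcontB.preimage_isClosed_of_isClosed isClosed_closedBall
    isClosed_singleton
  have hFc : IsCompact F := (isCompact_closedBall x₀ (ρ / 2)).of_isClosed_subset hFcl
    Set.inter_subset_left
  have hx₀F : x₀ ∈ F := ⟨mem_closedBall_self (by positivity), rfl⟩
  obtain ⟨p, hpF, hpmin⟩ := hFc.exists_infDist_eq_dist ⟨x₀, hx₀F⟩ q₀
  have hmin : ∀ x ∈ F, dist q₀ p ≤ dist q₀ x := fun x hx => hpmin ▸ infDist_le_dist_of_mem hx
  set r := dist q₀ p with hr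
  have hrpos : 0 < r := by
    refine dist_pos.2 fun h => hne ?_
    rw [h]; exact hpF.2
  have hrle : r < ρ / 4 := (hmin x₀ hx₀F).trans_lt hq₀
  have hpx₀ : dist p x₀ < ρ / 2 := by
    calc dist p x₀ ≤ dist p q₀ + dist q₀ x₀ := dist_triangle _ _ _
      _ < ρ / 4 + ρ / 4 := by rw [dist_comm p]; exact add_lt_add hrle hq₀
      _ = ρ / 2 := by ring
  -- the touching ball
  set z : ℝ² := midpoint ℝ q₀ p with hz
  have hzp : dist p z = r / 2 := by rw [hz, dist_right_midpoint]; simp; rw [← hr]; ring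
  have hzq : dist z q₀ = r / 2 := by rw [hz, dist_midpoint_left]; simp; rw [← hr]; ring
  have htouch : ∀ x ∈ closedBall z (r / 2), x ∈ closedBall x₀ (ρ / 2) → x ≠ p → u x < u x₀ := by
    intro x hx hxB hxp
    refine lt_of_le_of_ne (hmax x (closedBall_subset_ball (by linarith) hxB)) fun hux => ?_
    have hxF : r ≤ dist q₀ x := hmin x ⟨hxB, hux⟩
    have h1 : dist q₀ z + dist z x = dist q₀ x := by
      refine le_antisymm ?_ (dist_triangle _ _ _)
      rw [dist_comm q₀ z, hzq, dist_comm z x]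
      linarith [mem_closedBall.1 hx]
    have h2 : dist z x = r / 2 := by
      apply le_antisymm
      · rw [dist_comm]; exact hx
      · rw [dist_comm q₀ z, hzq] at h1; linarith
    apply hxp
    have h3 : z = midpoint ℝ q₀ x := eq_midpoint_of_dist_eq_half
      (by rw [← h1, dist_comm q₀ z, hzq, h2]; ring) (by rw [← h1, dist_comm q₀ z, hzq, h2]; ring)
    have h4 : midpoint ℝ q₀ x = midpoint ℝ q₀ p := h3.symm.trans hz
    rw [midpoint_eq_smul_add, midpoint_eq_smul_add] at h4
    simpa using h4
  -- the small ball around the touching point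
  obtain ⟨δ, hδ, hδr, hδB⟩ : ∃ δ > 0, δ < r / 4 ∧ closedBall p δ ⊆ closedBall x₀ (ρ / 2) := by
    refine ⟨min (r / 8) (ρ / 2 - dist p x₀), by
      refine lt_min (by positivity) (by linarith), ?_, ?_⟩
    · exact (min_le_left _ _).trans_lt (by linarith)
    · refine closedBall_subset_closedBall' ?_
      have := min_le_right (r / 8) (ρ / 2 - dist p x₀)
      linarith
  have hδρ : closedBall p δ ⊆ ball x₀ ρ := hδB.trans (closedBall_subset_ball (by linarith))
  have hann : ∀ x ∈ closedBall p δ, r / 4 ≤ ‖x - z‖ ∧ ‖x - z‖ ≤ r := by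
    intro x hx
    rw [← dist_eq_norm]
    rw [mem_closedBall] at hx
    have h1 := dist_triangle p x z
    have h2 := dist_triangle x p z
    rw [dist_comm p x] at h1
    constructor <;> linarith
  set α := (|Lam| + C * r + 1) / (2 * lam * (r / 4) ^ 2) with hα
  have hαpos : 0 < α := by positivity
  have hαbig : Lam + C * r < 2 * α * lam * (r / 4) ^ 2 := by
    have : 2 * α * lam * (r / 4) ^ 2 = |Lam| + C * r + 1 := by rw [hα]; field_simp
    rw [this]; linarith [le_abs_self Lam]
  set ψ := gaussianBarrier α z with hψ
  have hψc : Continuous ψ := (contDiff_gaussianBarrier α z).continuous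
  have hψp : ∀ x, r / 2 < ‖x - z‖ → ψ x < ψ p := by
    intro x hx
    rw [hψ, gaussianBarrier, gaussianBarrier, Real.exp_lt_exp, ← dist_eq_norm p, hzp]
    have : (r / 2) ^ 2 < ‖x - z‖ ^ 2 := by gcongr
    nlinarith
  -- on the part of the sphere in the touching ball, `u` stays below its maximum
  have hS : IsCompact (sphere p δ ∩ closedBall z (r / 2)) :=
    (isCompact_sphere p δ).inter_right isClosed_closedBall
  obtain ⟨ε, hε, hεS⟩ : ∃ ε > 0, ∀ x ∈ sphere p δ ∩ closedBall z (r / 2),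
      u x + ε * ψ x < u x₀ + ε * ψ p := by
    rcases (sphere p δ ∩ closedBall z (r / 2)).eq_empty_or_nonempty with hemp | hnem
    · exact ⟨1, one_pos, fun x hx => by simp [hemp] at hx⟩
    · have hcS : ContinuousOn u (sphere p δ ∩ closedBall z (r / 2)) :=
        hcontB.mono (Set.inter_subset_left.trans (sphere_subset_closedBall.trans hδB))
      obtain ⟨y, hy, hymax⟩ := hS.exists_isMaxOn hnem hcS
      have hylt : u y < u x₀ := htouch y hy.2 (hδB (sphere_subset_closedBall hy.1)) (by
        rintro rfl
        have := hy.1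
        simp at this
        exact hδ.ne this)
      refine ⟨(u x₀ - u y) / 2, by linarith, fun x hx => ?_⟩
      have h1 : u x ≤ u y := hymax hx
      have h2 : ψ x ≤ 1 := by
        rw [hψ, gaussianBarrier, Real.exp_le_one_iff]
        have : 0 ≤ α * ‖x - z‖ ^ 2 := by positivity
        linarith
      have h3 : 0 < ψ p := Real.exp_pos _
      have h4 : (u x₀ - u y) / 2 * ψ x ≤ (u x₀ - u y) / 2 * 1 := by
        apply mul_le_mul_of_nonneg_left h2; linarith
      have h5 : 0 < (u x₀ - u y) / 2 * ψ p := mul_pos (by linarith) h3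
      linarith
  have hsph : ∀ x ∈ sphere p δ, u x + ε * ψ x < u x₀ + ε * ψ p := by
    intro x hx
    by_cases hxz : x ∈ closedBall z (r / 2)
    · exact hεS x ⟨hx, hxz⟩
    · rw [mem_closedBall, not_le, dist_eq_norm] at hxz
      have h1 := hmax x (hδρ (sphere_subset_closedBall hx))
      have h2 := mul_lt_mul_of_pos_left (hψp x hxz) hε
      linarith
  have hwc : ContinuousOn (fun x => u x + ε * ψ x) (closedBall p δ) :=
    (hcontB.mono hδB).add (continuous_const.mul hψc).continuousOn
  obtain ⟨q, hq, hqmax⟩ := (isCompact_closedBall p δ).exists_isMaxOn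
    ⟨p, mem_closedBall_self hδ.le⟩ hwc
  have hqb : q ∈ ball p δ := by
    refine lt_of_le_of_ne (mem_closedBall.1 hq) fun hqs => ?_
    have h1 := hsph q hqs
    have h2 : u p + ε * ψ p ≤ u q + ε * ψ q := hqmax (mem_closedBall_self hδ.le)
    have h3 : u p = u x₀ := hpF.2
    linarith
  have hqloc : IsLocalMax (fun x => u x + ε * ψ x) q :=
    (hqmax.on_subset ball_subset_closedBall).isLocalMax (isOpen_ball.mem_nhds hqb)
  have hqρ := hδρ hq
  exact not_isLocalMax_add_gaussianBarrier hlam (hu q hqρ) (hell q hqρ) (hLam q hqρ) hC0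
    (hC q hqρ) hε hαpos (by positivity) (hann q hq).1 (hann q hq).2 hαbig hqloc

section Surfaces

variable {W : Type*} [NormedAddCommGroup W] [NormedSpace ℝ W]

/-- `(ρ, θ, n)` is the coframe dual to the frame formed by the point `R`, the tangent vectors in
the image of `A` and the transversal vector `N`. -/
structure IsDualCoframe (R : W) (A : ℝ² →L[ℝ] W) (N : W) (ρ : W →L[ℝ] ℝ) (θ : W →L[ℝ] ℝ²)
    (n : W →L[ℝ] ℝ) : Prop where
  decomp : ∀ w, w = ρ w • R + A (θ w) + n w • N
  ρ_point : ρ R = 1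
  ρ_tangent : ∀ v, ρ (A v) = 0
  ρ_transversal : ρ N = 0
  θ_point : θ R = 0
  θ_tangent : ∀ v, θ (A v) = v
  θ_transversal : θ N = 0
  n_point : n R = 0
  n_tangent : ∀ v, n (A v) = 0
  n_transversal : n N = 1

/-- The linear map `(c, v, s) ↦ c R + A v + s N`. -/
noncomputable def frameMap (R : W) (A : ℝ² →L[ℝ] W) (N : W) : (ℝ × ℝ² × ℝ) →L[ℝ] W :=
  (ContinuousLinearMap.fst ℝ ℝ (ℝ² × ℝ)).smulRight R
    + A.comp ((ContinuousLinearMap.fst ℝ ℝ² ℝ).comp (ContinuousLinearMap.snd ℝ ℝ (ℝ² × ℝ)))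
    + ((ContinuousLinearMap.snd ℝ ℝ² ℝ).comp
        (ContinuousLinearMap.snd ℝ ℝ (ℝ² × ℝ))).smulRight N

theorem frameMap_apply (R : W) (A : ℝ² →L[ℝ] W) (N : W) (y : ℝ × ℝ² × ℝ) :
    frameMap R A N y = y.1 • R + A y.2.1 + y.2.2 • N := rfl

theorem isDualCoframe_of_inverse {R : W} {A : ℝ² →L[ℝ] W} {N : W}
    (e : (ℝ × ℝ² × ℝ) ≃L[ℝ] W) (he : (e : (ℝ × ℝ² × ℝ) →L[ℝ] W) = frameMap R A N) :
    IsDualCoframe R A N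
      ((ContinuousLinearMap.fst ℝ ℝ (ℝ² × ℝ)).comp (e.symm : W →L[ℝ] (ℝ × ℝ² × ℝ)))
      (((ContinuousLinearMap.fst ℝ ℝ² ℝ).comp (ContinuousLinearMap.snd ℝ ℝ (ℝ² × ℝ))).comp
        (e.symm : W →L[ℝ] (ℝ × ℝ² × ℝ)))
      (((ContinuousLinearMap.snd ℝ ℝ² ℝ).comp (ContinuousLinearMap.snd ℝ ℝ (ℝ² × ℝ))).comp
        (e.symm : W →L[ℝ] (ℝ × ℝ² × ℝ))) := by
  have hap : ∀ y, e y = y.1 • R + A y.2.1 + y.2.2 • N := fun y => by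
    rw [← frameMap_apply, ← he]; rfl
  have h1 : e.symm R = (1, 0, 0) := by rw [e.symm_apply_eq, hap]; simp
  have h2 : ∀ v, e.symm (A v) = (0, v, 0) := fun v => by rw [e.symm_apply_eq, hap]; simp
  have h3 : e.symm N = (0, 0, 1) := by rw [e.symm_apply_eq, hap]; simp
  refine ⟨fun w => ?_, ?_, ?_, ?_, ?_, ?_, ?_, ?_, ?_, ?_⟩
  · have := hap (e.symm w)
    rw [e.apply_symm_apply] at this
    exact this
  all_goals simp [h1, h2, h3]

theorem exists_frameMap_equiv [FiniteDimensional ℝ W] (hW : Module.finrank ℝ W = 4)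
    {R : W} {A : ℝ² →L[ℝ] W} {N : W} {n : W →L[ℝ] ℝ}
    (hind : ∀ (c : ℝ) v, c • R + A v = 0 → c = 0 ∧ v = 0)
    (hnR : n R = 0) (hnA : ∀ v, n (A v) = 0) (hnN : n N ≠ 0) :
    ∃ e : (ℝ × ℝ² × ℝ) ≃L[ℝ] W, (e : (ℝ × ℝ² × ℝ) →L[ℝ] W) = frameMap R A N := by
  have hinj : Function.Injective (frameMap R A N) := by
    rw [injective_iff_map_eq_zero]
    rintro ⟨c, v, s⟩ h
    rw [frameMap_apply] at h
    have hs : s = 0 := by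
      have := congrArg n h
      simpa [hnR, hnA, hnN] using this
    subst hs
    obtain ⟨rfl, rfl⟩ := hind c v (by simpa using h)
    rfl
  have hdim : Module.finrank ℝ (ℝ × ℝ² × ℝ) = Module.finrank ℝ W := by
    rw [hW]; simp
  exact ⟨(LinearEquiv.ofInjectiveOfFinrankEq (frameMap R A N : (ℝ × ℝ² × ℝ) →ₗ[ℝ] W) hinj
    hdim).toContinuousLinearEquiv, by ext <;> rfl⟩

/-- The dual coframe of a smooth frame is smooth. -/
theorem exists_smooth_dualCoframe [FiniteDimensional ℝ W] (hW : Module.finrank ℝ W = 4)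
    {U : Set ℝ²} {R : ℝ² → W} {n : ℝ² → W →L[ℝ] ℝ} {N : W}
    (hR : ∀ x ∈ U, ContDiffAt ℝ ∞ R x)
    (hind : ∀ x ∈ U, ∀ (c : ℝ) v, c • R x + fderiv ℝ R x v = 0 → c = 0 ∧ v = 0)
    (hnR : ∀ x ∈ U, n x (R x) = 0) (hndR : ∀ x ∈ U, ∀ v, n x (fderiv ℝ R x v) = 0)
    (hnN : ∀ x ∈ U, n x N ≠ 0) :
    ∃ (ρ : ℝ² → W →L[ℝ] ℝ) (θ : ℝ² → W →L[ℝ] ℝ²) (n' : ℝ² → W →L[ℝ] ℝ),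
      (∀ x ∈ U, ContDiffAt ℝ ∞ ρ x) ∧ (∀ x ∈ U, ContDiffAt ℝ ∞ θ x) ∧
      (∀ x ∈ U, ContDiffAt ℝ ∞ n' x) ∧
      ∀ x ∈ U, IsDualCoframe (R x) (fderiv ℝ R x) N (ρ x) (θ x) (n' x) := by
  set B : ℝ² → (ℝ × ℝ² × ℝ) →L[ℝ] W := fun x => frameMap (R x) (fderiv ℝ R x) N with hB
  have hBs : ∀ x ∈ U, ContDiffAt ℝ ∞ B x := by
    intro x hx
    have h1 := hR x hx
    have h2 : ContDiffAt ℝ ∞ (fderiv ℝ R) x := h1.fderiv_right (by simp)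
    exact ((contDiffAt_const.smulRight h1).add (h2.clm_comp contDiffAt_const)).add
      contDiffAt_const
  have heq : ∀ x ∈ U, ∃ e : (ℝ × ℝ² × ℝ) ≃L[ℝ] W, (e : (ℝ × ℝ² × ℝ) →L[ℝ] W) = B x :=
    fun x hx => exists_frameMap_equiv hW (hind x hx) (hnR x hx) (hndR x hx) (hnN x hx)
  have hIs : ∀ x ∈ U, ContDiffAt ℝ ∞ (fun y => (B y).inverse) x := by
    intro x hx
    obtain ⟨e, he⟩ := heq x hx
    have h1 : ContDiffAt ℝ ∞ ContinuousLinearMap.inverse (B x) := by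
      rw [← he]; exact contDiffAt_map_inverse e
    exact h1.comp x (hBs x hx)
  refine ⟨fun x => (ContinuousLinearMap.fst ℝ ℝ (ℝ² × ℝ)).comp (B x).inverse,
    fun x => ((ContinuousLinearMap.fst ℝ ℝ² ℝ).comp
      (ContinuousLinearMap.snd ℝ ℝ (ℝ² × ℝ))).comp (B x).inverse,
    fun x => ((ContinuousLinearMap.snd ℝ ℝ² ℝ).comp
      (ContinuousLinearMap.snd ℝ ℝ (ℝ² × ℝ))).comp (B x).inverse,
    fun x hx => contDiffAt_const.clm_comp (hIs x hx),
    fun x hx => contDiffAt_const.clm_comp (hIs x hx),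
    fun x hx => contDiffAt_const.clm_comp (hIs x hx), fun x hx => ?_⟩
  obtain ⟨e, he⟩ := heq x hx
  have := isDualCoframe_of_inverse e he
  rw [← ContinuousLinearMap.inverse_equiv e, he] at this
  exact this

/-- A bilinear form is skew if it changes sign under exchange of its arguments. -/
def IsSkewForm (Ω : W →L[ℝ] W →L[ℝ] ℝ) : Prop := ∀ w w', Ω w w' = -Ω w' w

/-- The skew form on the ambient space that is determined by its values `T` on the point `R` and
`T'` on the tangent vectors. -/
noncomputable def rotationForm (T : W →L[ℝ] ℝ) (T' : ℝ² →L[ℝ] W →L[ℝ] ℝ) (N : W)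
    (ρ : W →L[ℝ] ℝ) (θ : W →L[ℝ] ℝ²) (n : W →L[ℝ] ℝ) : W →L[ℝ] W →L[ℝ] ℝ :=
  ρ.smulRight T + T'.comp θ -
    n.smulRight (T N • ρ + ((ContinuousLinearMap.apply ℝ ℝ N).comp T').comp θ)

theorem rotationForm_apply (T : W →L[ℝ] ℝ) (T' : ℝ² →L[ℝ] W →L[ℝ] ℝ) (N : W)
    (ρ : W →L[ℝ] ℝ) (θ : W →L[ℝ] ℝ²) (n : W →L[ℝ] ℝ) (w w' : W) :
    rotationForm T T' N ρ θ n w w' =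
      ρ w * T w' + T' (θ w) w' - n w * (T N * ρ w' + T' (θ w') N) := rfl

namespace IsDualCoframe

variable {R N : W} {A : ℝ² →L[ℝ] W} {ρ : W →L[ℝ] ℝ} {θ : W →L[ℝ] ℝ²} {n : W →L[ℝ] ℝ}
  (h : IsDualCoframe R A N ρ θ n) {T : W →L[ℝ] ℝ} {T' : ℝ² →L[ℝ] W →L[ℝ] ℝ}

include h

theorem rotationForm_point : rotationForm T T' N ρ θ n R = T := by
  ext w
  simp [rotationForm_apply, h.ρ_point, h.θ_point, h.n_point]

theorem rotationForm_tangent (v : ℝ²) : rotationForm T T' N ρ θ n (A v) = T' v := by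
  ext w
  simp [rotationForm_apply, h.ρ_tangent, h.θ_tangent, h.n_tangent]

theorem isSkewForm_rotationForm (hTR : T R = 0) (hTA : ∀ v, T' v R = -T (A v))
    (hskew : ∀ v w, T' v (A w) + T' w (A v) = 0) : IsSkewForm (rotationForm T T' N ρ θ n) := by
  intro w w'
  rw [rotationForm_apply, rotationForm_apply]
  have h1 : ∀ w, T w = T (A (θ w)) + n w * T N := fun w => by
    conv_lhs => rw [h.decomp w]
    simp [hTR]
  have h2 : ∀ v w, T' v w = -ρ w * T (A v) + T' v (A (θ w)) + n w * T' v N := fun v w => by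
    conv_lhs => rw [h.decomp w]
    simp [hTA]
  rw [h1 w, h1 w', h2 (θ w) w', h2 (θ w') w]
  linear_combination hskew (θ w) (θ w')

/-- A skew form is determined by its values on the point and on the tangent vectors. -/
theorem ext_skewForm {Ω Ω' : W →L[ℝ] W →L[ℝ] ℝ} (hΩ : IsSkewForm Ω) (hΩ' : IsSkewForm Ω')
    (hR : Ω R = Ω' R) (hA : ∀ v, Ω (A v) = Ω' (A v)) : Ω = Ω' := by
  ext w w'
  have hN : Ω N = Ω' N := by
    ext y
    have h0 : Ω N N = 0 := by linarith [hΩ N N]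
    have h0' : Ω' N N = 0 := by linarith [hΩ' N N]
    rw [h.decomp y]
    simp only [map_add, map_smul, hΩ N R, hΩ' N R, hΩ N (A _), hΩ' N (A _), hR, hA, h0, h0']
  conv_lhs => rw [h.decomp w]
  conv_rhs => rw [h.decomp w]
  simp only [map_add, map_smul, hR, hA, hN]

end IsDualCoframe

/-- The first coordinate vector of the plane. -/
local notation "𝐞₀" => (EuclideanSpace.single (0 : Fin 2) (1 : ℝ) : EuclideanSpace ℝ (Fin 2))
/-- The second coordinate vector of the plane. -/
local notation "𝐞₁" => (EuclideanSpace.single (1 : Fin 2) (1 : ℝ) : EuclideanSpace ℝ (Fin 2))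

theorem plane_decomp (v : ℝ²) : v = v 0 • 𝐞₀ + v 1 • 𝐞₁ := by
  ext i; fin_cases i <;> simp

/-- The second directional derivative of a map on the plane. -/
noncomputable def sndDeriv {F : Type*} [NormedAddCommGroup F] [NormedSpace ℝ F] (f : ℝ² → F)
    (x k j : ℝ²) : F :=
  fderiv ℝ (fderiv ℝ f) x k j

theorem fderiv_fderiv_apply_const {F : Type*} [NormedAddCommGroup F] [NormedSpace ℝ F]
    {f : ℝ² → F} {x : ℝ²} (hf : ContDiffAt ℝ ∞ f x) (j k : ℝ²) :
    fderiv ℝ (fun y => fderiv ℝ f y j) x k = sndDeriv f x k j := by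
  have h : DifferentiableAt ℝ (fderiv ℝ f) x :=
    (hf.fderiv_right (m := ∞) (by simp)).differentiableAt (by simp)
  rw [fderiv_clm_apply h (differentiableAt_const j)]
  simp [sndDeriv]

theorem snd_fderiv_symm {F : Type*} [NormedAddCommGroup F] [NormedSpace ℝ F]
    {f : ℝ² → F} {x : ℝ²} (hf : ContDiffAt ℝ ∞ f x) (j k : ℝ²) :
    sndDeriv f x j k = sndDeriv f x k j :=
  (hf.isSymmSndFDerivAt (by simp; norm_cast)).eq j k

theorem fderiv_clm_apply_apply {F G : Type*} [NormedAddCommGroup F] [NormedSpace ℝ F]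
    [NormedAddCommGroup G] [NormedSpace ℝ G] {c : ℝ² → F →L[ℝ] G} {u : ℝ² → F} {x : ℝ²}
    (hc : ContDiffAt ℝ ∞ c x) (hu : ContDiffAt ℝ ∞ u x) (v : ℝ²) :
    fderiv ℝ (fun y => c y (u y)) x v = c x (fderiv ℝ u x v) + fderiv ℝ c x v (u x) := by
  rw [fderiv_clm_apply (hc.differentiableAt (by simp)) (hu.differentiableAt (by simp))]
  simp

theorem ContDiffAt.fderiv_apply_const {F : Type*} [NormedAddCommGroup F] [NormedSpace ℝ F]
    {f : ℝ² → F} {x : ℝ²} (hf : ContDiffAt ℝ ∞ f x) (j : ℝ²) :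
    ContDiffAt ℝ ∞ (fun y => fderiv ℝ f y j) x :=
  (hf.fderiv_right (m := ∞) (by simp)).clm_apply contDiffAt_const

/-- A field of skew forms along a surface `R` in a vector space, whose derivative annihilates the
surface and is symmetric on its tangent vectors; the infinitesimal rotations of an infinitesimal
isometric deformation form such a field. -/
structure IsRotationField (U : Set ℝ²) (R : ℝ² → W) (Ω : ℝ² → W →L[ℝ] W →L[ℝ] ℝ) : Prop where
  isOpen : IsOpen U
  smooth_surface : ∀ x ∈ U, ContDiffAt ℝ ∞ R x
  smooth : ∀ x ∈ U, ContDiffAt ℝ ∞ Ω x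
  skew : ∀ x ∈ U, IsSkewForm (Ω x)
  point : ∀ x ∈ U, ∀ v, fderiv ℝ Ω x v (R x) = 0
  tangent : ∀ x ∈ U, ∀ v w,
    fderiv ℝ Ω x v (fderiv ℝ R x w) = fderiv ℝ Ω x w (fderiv ℝ R x v)

theorem isRotationField_of_values {U : Set ℝ²} (hU : IsOpen U) {R : ℝ² → W}
    {Ω : ℝ² → W →L[ℝ] W →L[ℝ] ℝ} {T : ℝ² → W →L[ℝ] ℝ} (hR : ∀ x ∈ U, ContDiffAt ℝ ∞ R x)
    (hT : ∀ x ∈ U, ContDiffAt ℝ ∞ T x)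
    (hΩ : ∀ x ∈ U, ContDiffAt ℝ ∞ Ω x) (hskew : ∀ x ∈ U, IsSkewForm (Ω x))
    (h0 : ∀ x ∈ U, Ω x (R x) = T x) (h1 : ∀ x ∈ U, ∀ v, Ω x (fderiv ℝ R x v) = fderiv ℝ T x v) :
    IsRotationField U R Ω := by
  refine ⟨hU, hR, hΩ, hskew, fun x hx v => ?_, fun x hx v w => ?_⟩
  · have h2 := fderiv_clm_apply_apply (hΩ x hx) (hR x hx) v
    have h3 : (fun y => Ω y (R y)) =ᶠ[𝓝 x] T := by
      filter_upwards [hU.mem_nhds hx] with y hy using h0 y hy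
    rw [h3.fderiv_eq, h1 x hx] at h2
    simpa using h2
  · have key : ∀ v w, fderiv ℝ Ω x v (fderiv ℝ R x w) =
        sndDeriv T x v w - Ω x (sndDeriv R x v w) := by
      intro v w
      have h2 := fderiv_clm_apply_apply (hΩ x hx) ((hR x hx).fderiv_apply_const w) v
      have h3 : (fun y => Ω y (fderiv ℝ R y w)) =ᶠ[𝓝 x] fun y => fderiv ℝ T y w := by
        filter_upwards [hU.mem_nhds hx] with y hy using h1 y hy w
      rw [h3.fderiv_eq, fderiv_fderiv_apply_const (hT x hx),
        fderiv_fderiv_apply_const (hR x hx)] at h2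
      rw [h2]; abel
    rw [key v w, key w v, snd_fderiv_symm (hT x hx), snd_fderiv_symm (hR x hx)]

namespace IsRotationField

variable {U : Set ℝ²} {R : ℝ² → W} {Ω : ℝ² → W →L[ℝ] W →L[ℝ] ℝ} (h : IsRotationField U R Ω)
  {x : ℝ²} (hx : x ∈ U)

include h hx

theorem fderiv_entry (w w' : W) (v : ℝ²) :
    fderiv ℝ (fun y => Ω y w w') x v = fderiv ℝ Ω x v w w' := by
  have h1 := h.smooth x hx
  rw [fderiv_clm_apply_apply (h1.clm_apply contDiffAt_const) contDiffAt_const]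
  rw [fderiv_clm_apply_apply h1 contDiffAt_const]
  simp

theorem contDiffAt_entry (w w' : W) : ContDiffAt ℝ ∞ (fun y => Ω y w w') x :=
  ((h.smooth x hx).clm_apply contDiffAt_const).clm_apply contDiffAt_const

theorem snd_fderiv_entry (w w' : W) (k i : ℝ²) :
    sndDeriv (fun y => Ω y w w') x k i = sndDeriv Ω x k i w w' := by
  rw [← fderiv_fderiv_apply_const (h.contDiffAt_entry hx w w')]
  have h3 : (fun y => fderiv ℝ (fun y => Ω y w w') y i) =ᶠ[𝓝 x] fun y => fderiv ℝ Ω y i w w' := by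
    filter_upwards [h.isOpen.mem_nhds hx] with y hy using h.fderiv_entry hy w w' i
  rw [h3.fderiv_eq]
  have h1 := (h.smooth x hx).fderiv_apply_const i
  rw [fderiv_clm_apply_apply (h1.clm_apply contDiffAt_const) contDiffAt_const]
  rw [fderiv_clm_apply_apply h1 contDiffAt_const, fderiv_fderiv_apply_const (h.smooth x hx)]
  simp

theorem skew_fderiv (v : ℝ²) : IsSkewForm (fderiv ℝ Ω x v) := by
  intro w w'
  rw [← h.fderiv_entry hx, ← h.fderiv_entry hx]
  have h3 : (fun y => Ω y w w') =ᶠ[𝓝 x] fun y => -Ω y w' w := by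
    filter_upwards [h.isOpen.mem_nhds hx] with y hy using h.skew y hy w w'
  rw [h3.fderiv_eq, fderiv_fun_neg]
  rfl

theorem skew_snd_fderiv (k i : ℝ²) : IsSkewForm (sndDeriv Ω x k i) := by
  intro w w'
  rw [← h.snd_fderiv_entry hx, ← h.snd_fderiv_entry hx,
    ← fderiv_fderiv_apply_const (h.contDiffAt_entry hx w w'),
    ← fderiv_fderiv_apply_const (h.contDiffAt_entry hx w' w)]
  have h3 : (fun y => fderiv ℝ (fun y => Ω y w w') y i) =ᶠ[𝓝 x]
      fun y => -fderiv ℝ (fun y => Ω y w' w) y i := by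
    filter_upwards [h.isOpen.mem_nhds hx] with y hy
    rw [h.fderiv_entry hy, h.fderiv_entry hy, h.skew_fderiv hy i w w']
  rw [h3.fderiv_eq, fderiv_fun_neg]
  rfl

theorem fderiv_tangent_tangent (i j l : ℝ²) :
    fderiv ℝ Ω x i (fderiv ℝ R x j) (fderiv ℝ R x l) = 0 := by
  have h1 := h.tangent x hx
  have h2 := fun v => h.skew_fderiv hx v
  have e1 := h2 i (fderiv ℝ R x j) (fderiv ℝ R x l)
  have e2 := h2 j (fderiv ℝ R x i) (fderiv ℝ R x l)
  have e3 := h2 l (fderiv ℝ R x i) (fderiv ℝ R x j)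
  rw [h1 i j] at e1 ⊢
  rw [h1 j l] at e2
  rw [h1 l i] at e3
  linarith

theorem snd_fderiv_point (k i : ℝ²) :
    sndDeriv Ω x k i (R x) = -fderiv ℝ Ω x i (fderiv ℝ R x k) := by
  have h2 := fderiv_clm_apply_apply ((h.smooth x hx).fderiv_apply_const i)
    (h.smooth_surface x hx) k
  have h3 : (fun y => fderiv ℝ Ω y i (R y)) =ᶠ[𝓝 x] fun _ => 0 := by
    filter_upwards [h.isOpen.mem_nhds hx] with y hy using h.point y hy i
  rw [h3.fderiv_eq, fderiv_fderiv_apply_const (h.smooth x hx)] at h2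
  simp only [fderiv_fun_const, Pi.zero_apply, zero_apply] at h2
  exact eq_neg_of_add_eq_zero_right h2.symm

theorem fderiv_fderiv_tangent (k i j : ℝ²) :
    fderiv ℝ (fun y => fderiv ℝ Ω y i (fderiv ℝ R y j)) x k =
      fderiv ℝ Ω x i (sndDeriv R x k j)
        + sndDeriv Ω x k i (fderiv ℝ R x j) := by
  rw [fderiv_clm_apply_apply ((h.smooth x hx).fderiv_apply_const i)
    ((h.smooth_surface x hx).fderiv_apply_const j), fderiv_fderiv_apply_const (h.smooth x hx),
    fderiv_fderiv_apply_const (h.smooth_surface x hx)]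

theorem contDiffAt_fderiv_tangent (i j : ℝ²) :
    ContDiffAt ℝ ∞ (fun y => fderiv ℝ Ω y i (fderiv ℝ R y j)) x :=
  ((h.smooth x hx).fderiv_apply_const i).clm_apply
    ((h.smooth_surface x hx).fderiv_apply_const j)

theorem snd_fderiv_tangent_tangent (k i j l : ℝ²) :
    sndDeriv Ω x k i (fderiv ℝ R x j) (fderiv ℝ R x l) =
      -fderiv ℝ Ω x i (sndDeriv R x k j) (fderiv ℝ R x l)
        - fderiv ℝ Ω x i (fderiv ℝ R x j) (sndDeriv R x k l) := by
  have h2 := fderiv_clm_apply_apply (h.contDiffAt_fderiv_tangent hx i j)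
    ((h.smooth_surface x hx).fderiv_apply_const l) k
  have h3 : (fun y => fderiv ℝ Ω y i (fderiv ℝ R y j) (fderiv ℝ R y l)) =ᶠ[𝓝 x] fun _ => 0 := by
    filter_upwards [h.isOpen.mem_nhds hx] with y hy using h.fderiv_tangent_tangent hy i j l
  rw [h3.fderiv_eq, h.fderiv_fderiv_tangent hx,
    fderiv_fderiv_apply_const (h.smooth_surface x hx)] at h2
  simp only [fderiv_fun_const, Pi.zero_apply, zero_apply, add_apply] at h2
  linarith

/-- The derivative of `y ↦ ∂ᵢΩ(∂ⱼR, N)` for a constant vector `N`. -/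
theorem snd_fderiv_tangent_const (N : W) (k i j : ℝ²) :
    sndDeriv Ω x k i (fderiv ℝ R x j) N =
      fderiv ℝ (fun y => fderiv ℝ Ω y i (fderiv ℝ R y j) N) x k
        - fderiv ℝ Ω x i (sndDeriv R x k j) N := by
  rw [fderiv_clm_apply_apply (h.contDiffAt_fderiv_tangent hx i j) contDiffAt_const,
    h.fderiv_fderiv_tangent hx]
  simp

theorem fderiv_shape_symm (N : W) (i j k : ℝ²) :
    fderiv ℝ (fun y => fderiv ℝ Ω y i (fderiv ℝ R y j) N) x k =
      fderiv ℝ (fun y => fderiv ℝ Ω y j (fderiv ℝ R y i) N) x k := by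
  have h3 : (fun y => fderiv ℝ Ω y i (fderiv ℝ R y j) N) =ᶠ[𝓝 x]
      fun y => fderiv ℝ Ω y j (fderiv ℝ R y i) N := by
    filter_upwards [h.isOpen.mem_nhds hx] with y hy
    rw [h.tangent y hy]
  rw [h3.fderiv_eq]

/-- A Codazzi equation for the symmetric tensor `∂ᵢΩ(∂ⱼR, N)`. -/
theorem codazzi (N : W) (k i j : ℝ²) :
    sndDeriv Ω x k i (fderiv ℝ R x j) N =
      fderiv ℝ (fun y => fderiv ℝ Ω y k (fderiv ℝ R y i) N) x j
        - fderiv ℝ Ω x k (sndDeriv R x j i) N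
        + fderiv ℝ Ω x j (sndDeriv R x k i) N
        - fderiv ℝ Ω x i (sndDeriv R x k j) N := by
  have e1 := h.snd_fderiv_tangent_const hx N k i j
  have e2 := h.snd_fderiv_tangent_const hx N k j i
  have e3 := h.snd_fderiv_tangent_const hx N j k i
  have e4 := h.fderiv_shape_symm hx N i j k
  rw [snd_fderiv_symm (h.smooth x hx) k j] at e2
  linarith

section Coframe

variable {N : W} {ρ : W →L[ℝ] ℝ} {θ : W →L[ℝ] ℝ²} {n : W →L[ℝ] ℝ}
  (hc : IsDualCoframe (R x) (fderiv ℝ R x) N ρ θ n)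

include hc

theorem fderiv_apply_tangent (i : ℝ²) (j : ℝ²) (w : W) :
    fderiv ℝ Ω x i (fderiv ℝ R x j) w = n w * fderiv ℝ Ω x i (fderiv ℝ R x j) N := by
  have h0 : fderiv ℝ Ω x i (fderiv ℝ R x j) (R x) = 0 := by
    rw [h.skew_fderiv hx i, h.point x hx]; simp
  conv_lhs => rw [hc.decomp w]
  simp [h0, h.fderiv_tangent_tangent hx]

theorem fderiv_apply_const (i : ℝ²) (w : W) :
    fderiv ℝ Ω x i w N = fderiv ℝ Ω x i (fderiv ℝ R x (θ w)) N := by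
  have h0 : fderiv ℝ Ω x i N N = 0 := by linarith [h.skew_fderiv hx i N N]
  conv_lhs => rw [hc.decomp w]
  simp [h0, h.point x hx]

theorem fderiv_apply (i : ℝ²) (w w' : W) :
    fderiv ℝ Ω x i w w' = fderiv ℝ Ω x i (fderiv ℝ R x (n w' • θ w - n w • θ w')) N := by
  have h1 : fderiv ℝ Ω x i N w' = -fderiv ℝ Ω x i (fderiv ℝ R x (θ w')) N := by
    rw [h.skew_fderiv hx i N w', h.fderiv_apply_const hx hc]
  conv_lhs => rw [hc.decomp w]
  simp only [map_add, map_smul, map_sub, add_apply, smul_apply, sub_apply, h.point x hx,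
    h.fderiv_apply_tangent hx hc i (θ w) w', h1, smul_eq_mul, zero_apply]
  ring

theorem snd_fderiv_tangent_tangent_eq (k i j l : ℝ²) :
    sndDeriv Ω x k i (fderiv ℝ R x j) (fderiv ℝ R x l) =
      n (sndDeriv R x k j) * fderiv ℝ Ω x i (fderiv ℝ R x l) N
        - n (sndDeriv R x k l) * fderiv ℝ Ω x i (fderiv ℝ R x j) N := by
  rw [h.snd_fderiv_tangent_tangent hx, h.skew_fderiv hx i _ (fderiv ℝ R x l),
    h.fderiv_apply_tangent hx hc i l (sndDeriv R x k j),
    h.fderiv_apply_tangent hx hc i j (sndDeriv R x k l)]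
  ring

/-- The tensor `∂ᵢΩ(∂ⱼR, N)` is trace free with respect to the second fundamental form. -/
theorem trace_eq_zero :
    n (sndDeriv R x 𝐞₁ 𝐞₁) * fderiv ℝ Ω x 𝐞₀ (fderiv ℝ R x 𝐞₀) N
      - 2 * n (sndDeriv R x 𝐞₀ 𝐞₁) * fderiv ℝ Ω x 𝐞₀ (fderiv ℝ R x 𝐞₁) N
      + n (sndDeriv R x 𝐞₀ 𝐞₀) * fderiv ℝ Ω x 𝐞₁ (fderiv ℝ R x 𝐞₁) N = 0 := by
  have e1 := h.snd_fderiv_tangent_tangent_eq hx hc 𝐞₀ 𝐞₁ 𝐞₀ 𝐞₁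
  have e2 := h.snd_fderiv_tangent_tangent_eq hx hc 𝐞₁ 𝐞₀ 𝐞₀ 𝐞₁
  rw [snd_fderiv_symm (h.smooth x hx) 𝐞₁ 𝐞₀, e1, snd_fderiv_symm (h.smooth_surface x hx) 𝐞₁ 𝐞₀,
    h.tangent x hx 𝐞₁ 𝐞₀] at e2
  linarith

/-- The image of an entry of `Ω` under the elliptic operator of the second fundamental form. -/
theorem planeOperator_entry (w w' : W) :
    planeOperator (n (sndDeriv R x 𝐞₁ 𝐞₁)) (-n (sndDeriv R x 𝐞₀ 𝐞₁))
      (n (sndDeriv R x 𝐞₀ 𝐞₀)) (fderiv ℝ (fderiv ℝ fun y => Ω y w w') x) =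
    n (sndDeriv R x 𝐞₁ 𝐞₁) *
        sndDeriv Ω x 𝐞₀ 𝐞₀ (fderiv ℝ R x (n w' • θ w - n w • θ w')) N
      - 2 * n (sndDeriv R x 𝐞₀ 𝐞₁) *
        sndDeriv Ω x 𝐞₀ 𝐞₁ (fderiv ℝ R x (n w' • θ w - n w • θ w')) N
      + n (sndDeriv R x 𝐞₀ 𝐞₀) *
        sndDeriv Ω x 𝐞₁ 𝐞₁ (fderiv ℝ R x (n w' • θ w - n w • θ w')) N := by
  have hent : ∀ k i, fderiv ℝ (fderiv ℝ fun y => Ω y w w') x k i = sndDeriv Ω x k i w w' :=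
    h.snd_fderiv_entry hx w w'
  simp only [planeOperator, hent]
  have htr := h.trace_eq_zero hx hc
  set H : ℝ² → ℝ² → ℝ := fun i j => n (sndDeriv R x i j) with hH
  set S : ℝ² → ℝ² → ℝ := fun i j => fderiv ℝ Ω x i (fderiv ℝ R x j) N with hS
  set O : ℝ² → ℝ² → W →L[ℝ] W →L[ℝ] ℝ := fun k i => sndDeriv Ω x k i with hO
  set A := fderiv ℝ R x with hA
  have hR : ∀ k i w, O k i (R x) w = -(n w * S i k) := fun k i w => by
    simp only [hO, h.snd_fderiv_point hx, neg_apply, h.fderiv_apply_tangent hx hc i k w, hS]; rfl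
  have hskew : ∀ k i, IsSkewForm (O k i) := fun k i => h.skew_snd_fderiv hx k i
  have hRR : ∀ k i w, O k i w (R x) = n w * S i k := fun k i w => by
    rw [hskew k i, hR]; ring
  have hNN : ∀ k i, O k i N N = 0 := fun k i => by linarith [hskew k i N N]
  have hAA : ∀ k i j l, O k i (A j) (A l) = H k j * S i l - H k l * S i j :=
    h.snd_fderiv_tangent_tangent_eq hx hc
  have hexp : ∀ k i, O k i w w' = -(n w' * ρ w * S i k) + n w * ρ w' * S i k
      + O k i (A (n w' • θ w - n w • θ w')) N + O k i (A (θ w)) (A (θ w')) := by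
    intro k i
    have e1 : ∀ v, O k i v w' = ρ w' * (n v * S i k) + O k i v (A (θ w')) + n w' * O k i v N := by
      intro v
      conv_lhs => rw [hc.decomp w']
      simp [hRR]
    have e2 : O k i w w' = ρ w * O k i (R x) w' + O k i (A (θ w)) w' + n w * O k i N w' := by
      conv_lhs => rw [hc.decomp w]
      simp
    rw [e2, hR, e1 (A (θ w)), e1 N, hskew k i N (A (θ w')), hNN, hc.n_tangent, hc.n_transversal]
    simp only [map_sub, map_smul, sub_apply, smul_apply, smul_eq_mul]
    ring
  change H 𝐞₁ 𝐞₁ * S 𝐞₀ 𝐞₀ - 2 * H 𝐞₀ 𝐞₁ * S 𝐞₀ 𝐞₁ + H 𝐞₀ 𝐞₀ * S 𝐞₁ 𝐞₁ = 0 at htr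
  have hS10 : S 𝐞₁ 𝐞₀ = S 𝐞₀ 𝐞₁ := by simp only [hS, hA, h.tangent x hx 𝐞₁ 𝐞₀]
  have hH10 : H 𝐞₁ 𝐞₀ = H 𝐞₀ 𝐞₁ := by
    simp only [hH, snd_fderiv_symm (h.smooth_surface x hx) 𝐞₁ 𝐞₀]
  have hHlin : ∀ k v, H k v = v 0 * H k 𝐞₀ + v 1 * H k 𝐞₁ := fun k v => by
    conv_lhs => rw [plane_decomp v]
    simp [hH, sndDeriv]
  have hSlin : ∀ k v, S k v = v 0 * S k 𝐞₀ + v 1 * S k 𝐞₁ := fun k v => by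
    conv_lhs => rw [plane_decomp v]
    simp [hS]
  change H 𝐞₁ 𝐞₁ * O 𝐞₀ 𝐞₀ w w' + 2 * -H 𝐞₀ 𝐞₁ * O 𝐞₀ 𝐞₁ w w' + H 𝐞₀ 𝐞₀ * O 𝐞₁ 𝐞₁ w w' =
    H 𝐞₁ 𝐞₁ * O 𝐞₀ 𝐞₀ (A (n w' • θ w - n w • θ w')) N
      - 2 * H 𝐞₀ 𝐞₁ * O 𝐞₀ 𝐞₁ (A (n w' • θ w - n w • θ w')) N
      + H 𝐞₀ 𝐞₀ * O 𝐞₁ 𝐞₁ (A (n w' • θ w - n w • θ w')) N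
  rw [hexp 𝐞₀ 𝐞₀, hexp 𝐞₀ 𝐞₁, hexp 𝐞₁ 𝐞₁]
  simp only [hAA, hHlin _ (θ _), hSlin _ (θ _), hS10, hH10]
  linear_combination (n w * ρ w' - n w' * ρ w
    - H 𝐞₀ 𝐞₁ * (θ w 0 * θ w' 1 - θ w 1 * θ w' 0)) * htr

end Coframe

end IsRotationField

theorem abs_mul_le_mul {a b A B : ℝ} (ha : |a| ≤ A) (hb : |b| ≤ B) : |a * b| ≤ A * B := by
  rw [abs_mul]
  exact mul_le_mul ha hb (abs_nonneg _) ((abs_nonneg _).trans ha)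

/-- A symmetric matrix that is trace free with respect to a definite one has negative determinant,
with quantitative control. -/
theorem sq_le_neg_det_of_trace_eq_zero {a b c p q r d K : ℝ} (hd : 0 < d)
    (hdet : d ≤ a * c - b ^ 2) (ha : 0 < a) (hc : 0 < c) (haK : a ≤ K) (hcK : c ≤ K)
    (htr : c * p - 2 * b * q + a * r = 0) :
    0 ≤ q ^ 2 - p * r ∧ d ^ 3 * (|p| + |q| + |r|) ^ 2 ≤ 9 * K ^ 6 * (q ^ 2 - p * r) := by
  have hK : 0 < K := ha.trans_le haK
  set D := q ^ 2 - p * r with hD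
  have hac : a * c ≤ K ^ 2 := by rw [sq]; gcongr
  have hdK : d ≤ K ^ 2 := by nlinarith [sq_nonneg b]
  have hbK : b ^ 2 ≤ K ^ 2 := by nlinarith
  have key : 4 * (a * c) * D = 4 * (a * c - b ^ 2) * q ^ 2 + (c * p - a * r) ^ 2 := by
    have h1 : c * p = 2 * b * q - a * r := by linarith
    have h2 : (c * p + a * r) ^ 2 = 4 * b ^ 2 * q ^ 2 := by rw [h1]; ring
    rw [hD]
    linear_combination -h2
  have hD0 : 0 ≤ D := by
    have h1 : 0 ≤ 4 * (a * c) * D := by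
      rw [key]
      have : 0 ≤ a * c - b ^ 2 := by linarith
      positivity
    exact nonneg_of_mul_nonneg_right h1 (by positivity)
  have hacD : a * c * D ≤ K ^ 2 * D := by gcongr
  have hq : d * q ^ 2 ≤ K ^ 2 * D := by
    have : d * q ^ 2 ≤ (a * c - b ^ 2) * q ^ 2 := by gcongr
    nlinarith [sq_nonneg (c * p - a * r)]
  have hpr : d * ((c * p) ^ 2 + (a * r) ^ 2) ≤ 2 * K ^ 4 * D := by
    have h1 : c * p = 2 * b * q - a * r := by linarith
    have h2 : (c * p + a * r) ^ 2 = 4 * b ^ 2 * q ^ 2 := by rw [h1]; ring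
    have h3 : b ^ 2 * (d * q ^ 2) ≤ K ^ 2 * ((a * c - b ^ 2) * q ^ 2) := by gcongr
    have h4 : d * (c * p - a * r) ^ 2 ≤ K ^ 2 * (c * p - a * r) ^ 2 := by gcongr
    have h5 : K ^ 2 * (a * c * D) ≤ K ^ 2 * (K ^ 2 * D) := by gcongr
    have h6 : d * ((c * p) ^ 2 + (a * r) ^ 2)
        = 2 * (b ^ 2 * (d * q ^ 2)) + d * (c * p - a * r) ^ 2 / 2 := by
      linear_combination (d / 2) * h2
    rw [h6]
    nlinarith
  have hcd : d ≤ K * c := by nlinarith [sq_nonneg b, mul_le_mul_of_nonneg_right haK hc.le]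
  have had : d ≤ K * a := by nlinarith [sq_nonneg b, mul_le_mul_of_nonneg_left hcK ha.le]
  have hp2 : d ^ 3 * (p ^ 2 + r ^ 2) ≤ 2 * K ^ 6 * D := by
    have h1 : d ^ 2 * p ^ 2 ≤ (K * c) ^ 2 * p ^ 2 := by gcongr
    have h2 : d ^ 2 * r ^ 2 ≤ (K * a) ^ 2 * r ^ 2 := by gcongr
    have h3 : d * (d ^ 2 * p ^ 2 + d ^ 2 * r ^ 2) ≤
        d * ((K * c) ^ 2 * p ^ 2 + (K * a) ^ 2 * r ^ 2) := by gcongr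
    have h4 : K ^ 2 * (d * ((c * p) ^ 2 + (a * r) ^ 2)) ≤ K ^ 2 * (2 * K ^ 4 * D) := by gcongr
    nlinarith
  have hq2 : d ^ 3 * q ^ 2 ≤ K ^ 6 * D := by
    have h1 : d ^ 2 * (d * q ^ 2) ≤ (K ^ 2) ^ 2 * (K ^ 2 * D) := by gcongr
    nlinarith
  set σ := |p| + |q| + |r| with hσ
  have hσ0 : 0 ≤ σ := by positivity
  have hσ2 : σ ^ 2 ≤ 3 * (p ^ 2 + q ^ 2 + r ^ 2) := by
    rw [hσ, ← sq_abs p, ← sq_abs q, ← sq_abs r]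
    nlinarith [sq_nonneg (|p| - |q|), sq_nonneg (|q| - |r|), sq_nonneg (|p| - |r|)]
  have hσD : d ^ 3 * σ ^ 2 ≤ 9 * K ^ 6 * D := by
    have : d ^ 3 * σ ^ 2 ≤ d ^ 3 * (3 * (p ^ 2 + q ^ 2 + r ^ 2)) := by gcongr
    nlinarith
  exact ⟨hD0, hσD⟩

/-- A symmetric matrix that is trace free with respect to a definite one is invertible, with
quantitative control. -/
theorem norm_mul_norm_le_of_trace_eq_zero {a b c p q r d K : ℝ} (hd : 0 < d)
    (hdet : d ≤ a * c - b ^ 2) (ha : 0 < a) (hc : 0 < c) (haK : a ≤ K) (hcK : c ≤ K)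
    (htr : c * p - 2 * b * q + a * r = 0) (X Y : ℝ) :
    (|p| + |q| + |r|) * (|X| + |Y|) ≤
      18 * K ^ 6 / d ^ 3 * (|p * X + q * Y| + |q * X + r * Y|) := by
  have hK : 0 < K := ha.trans_le haK
  obtain ⟨hD0, hσD⟩ := sq_le_neg_det_of_trace_eq_zero hd hdet ha hc haK hcK htr
  set D := q ^ 2 - p * r with hD
  set σ := |p| + |q| + |r| with hσ
  have hσ0 : 0 ≤ σ := by positivity
  set y := p * X + q * Y with hy
  set z := q * X + r * Y with hz
  have hX : D * |X| ≤ σ * (|y| + |z|) := by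
    have h1 : D * X = q * z - r * y := by rw [hD, hy, hz]; ring
    rw [← abs_of_nonneg hD0, ← abs_mul, h1]
    calc |q * z - r * y| ≤ |q| * |z| + |r| * |y| := by
          rw [← abs_mul, ← abs_mul]; exact abs_sub _ _
      _ ≤ σ * |z| + σ * |y| := by
          gcongr
          · rw [hσ]; linarith [abs_nonneg p, abs_nonneg r]
          · rw [hσ]; linarith [abs_nonneg p, abs_nonneg q]
      _ = _ := by ring
  have hY : D * |Y| ≤ σ * (|y| + |z|) := by
    have h1 : D * Y = q * y - p * z := by rw [hD, hy, hz]; ring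
    rw [← abs_of_nonneg hD0, ← abs_mul, h1]
    calc |q * y - p * z| ≤ |q| * |y| + |p| * |z| := by
          rw [← abs_mul, ← abs_mul]; exact abs_sub _ _
      _ ≤ σ * |y| + σ * |z| := by
          gcongr
          · rw [hσ]; linarith [abs_nonneg p, abs_nonneg r]
          · rw [hσ]; linarith [abs_nonneg r, abs_nonneg q]
      _ = _ := by ring
  rcases hσ0.eq_or_lt with h0 | hσpos
  · rw [← h0, zero_mul]; positivity
  rw [div_mul_eq_mul_div, le_div_iff₀ (by positivity)]
  have h1 : σ * (d ^ 3 * (σ * (|X| + |Y|))) ≤ σ * (18 * K ^ 6 * (|y| + |z|)) := by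
    calc σ * (d ^ 3 * (σ * (|X| + |Y|))) = d ^ 3 * σ ^ 2 * (|X| + |Y|) := by ring
      _ ≤ 9 * K ^ 6 * D * (|X| + |Y|) := by gcongr
      _ = 9 * K ^ 6 * (D * |X| + D * |Y|) := by ring
      _ ≤ 9 * K ^ 6 * (σ * (|y| + |z|) + σ * (|y| + |z|)) := by gcongr
      _ = _ := by ring
  have := le_of_mul_le_mul_left h1 hσpos
  linarith

/-- A symmetric positive matrix is bounded below by the quotient of determinant and trace. -/
theorem quadratic_lower_bound {a b c d K : ℝ} (hd : 0 < d)
    (hdet : d ≤ a * c - b ^ 2) (ha : 0 < a) (hc : 0 < c) (haK : a ≤ K) (hcK : c ≤ K) (ξ η : ℝ) :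
    d / (2 * K) * (ξ ^ 2 + η ^ 2) ≤ c * ξ ^ 2 + 2 * -b * (ξ * η) + a * η ^ 2 := by
  have hK : 0 < K := ha.trans_le haK
  set Q := c * ξ ^ 2 + 2 * -b * (ξ * η) + a * η ^ 2 with hQ
  have h1 : (a + c) * Q = (a * c - b ^ 2) * (ξ ^ 2 + η ^ 2)
      + ((c * ξ - b * η) ^ 2 + (a * η - b * ξ) ^ 2) := by rw [hQ]; ring
  have h2 : d * (ξ ^ 2 + η ^ 2) ≤ (a * c - b ^ 2) * (ξ ^ 2 + η ^ 2) := by gcongr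
  have h3 : d * (ξ ^ 2 + η ^ 2) ≤ (a + c) * Q := by
    rw [h1]; nlinarith [sq_nonneg (c * ξ - b * η), sq_nonneg (a * η - b * ξ)]
  have hQ0 : 0 ≤ Q := nonneg_of_mul_nonneg_right
    ((by positivity : 0 ≤ d * (ξ ^ 2 + η ^ 2)).trans h3) (by positivity)
  have h4 : (a + c) * Q ≤ 2 * K * Q := by gcongr; linarith
  rw [div_mul_eq_mul_div, div_le_iff₀ (by positivity)]
  linarith

theorem ContDiffAt.sndDeriv {F : Type*} [NormedAddCommGroup F] [NormedSpace ℝ F]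
    {f : ℝ² → F} {x : ℝ²} (hf : ContDiffAt ℝ ∞ f x) (j k : ℝ²) :
    ContDiffAt ℝ ∞ (fun y => sndDeriv f y j k) x :=
  (((hf.fderiv_right (m := ∞) (by simp)).fderiv_right (m := ∞) (by simp)).clm_apply
    contDiffAt_const).clm_apply contDiffAt_const

theorem exists_eventually_abs_le {ι X : Type*} [Finite ι] [TopologicalSpace X] {x : X}
    {f : ι → X → ℝ} (hf : ∀ i, ContinuousAt (f i) x) :
    ∃ K, ∀ᶠ y in 𝓝 x, ∀ i, |f i y| ≤ K := by
  cases nonempty_fintype ι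
  refine ⟨∑ i, (|f i x| + 1), eventually_all.2 fun i => ?_⟩
  have h1 : ∀ᶠ y in 𝓝 x, |f i y| < |f i x| + 1 :=
    (hf i).abs.eventually (eventually_lt_nhds (by simp))
  filter_upwards [h1] with y hy
  exact hy.le.trans (Finset.single_le_sum (f := fun i => |f i x| + 1)
    (fun j _ => by positivity) (Finset.mem_univ i))

namespace IsRotationField

variable {U : Set ℝ²} {R : ℝ² → W} {Ω : ℝ² → W →L[ℝ] W →L[ℝ] ℝ} (h : IsRotationField U R Ω)
  {N : W} {ρ : ℝ² → W →L[ℝ] ℝ} {θ : ℝ² → W →L[ℝ] ℝ²} {n : ℝ² → W →L[ℝ] ℝ}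
  (hc : ∀ x ∈ U, IsDualCoframe (R x) (fderiv ℝ R x) N (ρ x) (θ x) (n x))
  (hn : ∀ x ∈ U, ContDiffAt ℝ ∞ n x)

include h hc

/-- The `i`th coordinate vector of the plane. -/
local notation "𝐞" i:max =>
  (EuclideanSpace.single (i : Fin 2) (1 : ℝ) : EuclideanSpace ℝ (Fin 2))

include hn in
theorem fderiv_trace {x : ℝ²} (hx : x ∈ U) (v : ℝ²) :
    n x (sndDeriv R x 𝐞₁ 𝐞₁) *
        fderiv ℝ (fun y => fderiv ℝ Ω y 𝐞₀ (fderiv ℝ R y 𝐞₀) N) x v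
      - 2 * n x (sndDeriv R x 𝐞₀ 𝐞₁) *
        fderiv ℝ (fun y => fderiv ℝ Ω y 𝐞₀ (fderiv ℝ R y 𝐞₁) N) x v
      + n x (sndDeriv R x 𝐞₀ 𝐞₀) *
        fderiv ℝ (fun y => fderiv ℝ Ω y 𝐞₁ (fderiv ℝ R y 𝐞₁) N) x v =
    -(fderiv ℝ (fun y => n y (sndDeriv R y 𝐞₁ 𝐞₁)) x v * fderiv ℝ Ω x 𝐞₀ (fderiv ℝ R x 𝐞₀) N
      - 2 * (fderiv ℝ (fun y => n y (sndDeriv R y 𝐞₀ 𝐞₁)) x v *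
        fderiv ℝ Ω x 𝐞₀ (fderiv ℝ R x 𝐞₁) N)
      + fderiv ℝ (fun y => n y (sndDeriv R y 𝐞₀ 𝐞₀)) x v *
        fderiv ℝ Ω x 𝐞₁ (fderiv ℝ R x 𝐞₁) N) := by
  have hS : ∀ i j, HasFDerivAt (fun y => fderiv ℝ Ω y i (fderiv ℝ R y j) N)
      (fderiv ℝ (fun y => fderiv ℝ Ω y i (fderiv ℝ R y j) N) x) x := fun i j =>
    (((h.contDiffAt_fderiv_tangent hx i j).clm_apply contDiffAt_const).differentiableAt
      (by simp)).hasFDerivAt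
  have hH : ∀ i j, HasFDerivAt (fun y => n y (sndDeriv R y i j))
      (fderiv ℝ (fun y => n y (sndDeriv R y i j)) x) x := fun i j =>
    (((hn x hx).clm_apply ((h.smooth_surface x hx).sndDeriv i j)).differentiableAt
      (by simp)).hasFDerivAt
  have h1 := (((hH 𝐞₁ 𝐞₁).mul (hS 𝐞₀ 𝐞₀)).sub
    (((hH 𝐞₀ 𝐞₁).const_mul 2).mul (hS 𝐞₀ 𝐞₁))).add ((hH 𝐞₀ 𝐞₀).mul (hS 𝐞₁ 𝐞₁))
  have h2 : HasFDerivAt (fun _ : ℝ² => (0 : ℝ)) (0 : ℝ² →L[ℝ] ℝ) x := hasFDerivAt_const _ _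
  have h3 := h1.unique (h2.congr_of_eventuallyEq (by
    filter_upwards [h.isOpen.mem_nhds hx] with y hy
    exact h.trace_eq_zero hy (hc y hy)))
  have h4 := congrArg (fun L : ℝ² →L[ℝ] ℝ => L v) h3
  simp only [add_apply, sub_apply, smul_apply, smul_eq_mul, zero_apply] at h4
  linarith

include hn in
/-- The entries of the rotation field satisfy an elliptic differential inequality. -/
theorem abs_planeOperator_entry_le {x : ℝ²} (hx : x ∈ U) {d K : ℝ} (hd : 0 < d)
    (hdet : d ≤ n x (sndDeriv R x 𝐞₀ 𝐞₀) * n x (sndDeriv R x 𝐞₁ 𝐞₁)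
      - n x (sndDeriv R x 𝐞₀ 𝐞₁) ^ 2)
    (hH0 : 0 < n x (sndDeriv R x 𝐞₀ 𝐞₀)) (hH1 : 0 < n x (sndDeriv R x 𝐞₁ 𝐞₁))
    (hHK : ∀ i j, |n x (sndDeriv R x (𝐞 i) (𝐞 j))| ≤ K)
    (hdHK : ∀ i j k, |fderiv ℝ (fun y => n y (sndDeriv R y (𝐞 i) (𝐞 j))) x (𝐞 k)| ≤ K)
    (hΓK : ∀ i j k, |θ x (sndDeriv R x (𝐞 i) (𝐞 j)) k| ≤ K) (w w' : W) :
    |planeOperator (n x (sndDeriv R x 𝐞₁ 𝐞₁)) (-n x (sndDeriv R x 𝐞₀ 𝐞₁))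
      (n x (sndDeriv R x 𝐞₀ 𝐞₀)) (fderiv ℝ (fderiv ℝ fun y => Ω y w w') x)| ≤
    (4 * K + 12 * K ^ 2) * (18 * K ^ 6 / d ^ 3 * 2) * ‖fderiv ℝ (fun y => Ω y w w') x‖ := by
  have hcx := hc x hx
  have hK : 0 ≤ K := (abs_nonneg _).trans (hHK 0 0)
  rw [h.planeOperator_entry hx hcx]
  set X : ℝ² := n x w' • θ x w - n x w • θ x w' with hX
  set S : ℝ² → ℝ² → ℝ := fun i j => fderiv ℝ Ω x i (fderiv ℝ R x j) N with hS
  have hSlin : ∀ k v, S k v = v 0 * S k 𝐞₀ + v 1 * S k 𝐞₁ := fun k v => by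
    conv_lhs => rw [plane_decomp v]
    simp [hS]
  have hS10 : S 𝐞₁ 𝐞₀ = S 𝐞₀ 𝐞₁ := by simp only [hS, h.tangent x hx 𝐞₁ 𝐞₀]
  set σ := |S 𝐞₀ 𝐞₀| + |S 𝐞₀ 𝐞₁| + |S 𝐞₁ 𝐞₁| with hσ
  have hσ0 : 0 ≤ σ := by positivity
  have h00 : |S 𝐞₀ 𝐞₀| ≤ σ := by
    rw [hσ]; linarith [abs_nonneg (S 𝐞₀ 𝐞₁), abs_nonneg (S 𝐞₁ 𝐞₁)]
  have h01 : |S 𝐞₀ 𝐞₁| ≤ σ := by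
    rw [hσ]; linarith [abs_nonneg (S 𝐞₀ 𝐞₀), abs_nonneg (S 𝐞₁ 𝐞₁)]
  have h11 : |S 𝐞₁ 𝐞₁| ≤ σ := by
    rw [hσ]; linarith [abs_nonneg (S 𝐞₀ 𝐞₀), abs_nonneg (S 𝐞₀ 𝐞₁)]
  -- the derivatives of the entry
  have hu : ∀ i, fderiv ℝ (fun y => Ω y w w') x i = S i X := fun i => by
    rw [h.fderiv_entry hx, h.fderiv_apply hx hcx]
  have hunorm : ∀ i, |S (𝐞 i) X| ≤ ‖fderiv ℝ (fun y => Ω y w w') x‖ := fun i => by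
    rw [← hu, ← Real.norm_eq_abs]
    refine (ContinuousLinearMap.le_opNorm _ _).trans_eq ?_
    simp
  -- the first order coefficients
  have hSK : ∀ i a b, |S (𝐞 i) (θ x (sndDeriv R x (𝐞 a) (𝐞 b)))| ≤ K * σ := by
    intro i a b
    rw [hSlin]
    set g := θ x (sndDeriv R x (𝐞 a) (𝐞 b)) with hg
    have hij : |S (𝐞 i) 𝐞₀| + |S (𝐞 i) 𝐞₁| ≤ σ := by
      fin_cases i
      · simp only [hσ, Fin.zero_eta]; linarith [abs_nonneg (S 𝐞₁ 𝐞₁)]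
      · simp only [hσ, Fin.mk_one, hS10]; linarith [abs_nonneg (S 𝐞₀ 𝐞₀)]
    calc |g 0 * S (𝐞 i) 𝐞₀ + g 1 * S (𝐞 i) 𝐞₁|
        ≤ |g 0 * S (𝐞 i) 𝐞₀| + |g 1 * S (𝐞 i) 𝐞₁| := abs_add_le _ _
      _ ≤ K * |S (𝐞 i) 𝐞₀| + K * |S (𝐞 i) 𝐞₁| :=
          add_le_add (abs_mul_le_mul (hΓK a b 0) le_rfl) (abs_mul_le_mul (hΓK a b 1) le_rfl)
      _ = K * (|S (𝐞 i) 𝐞₀| + |S (𝐞 i) 𝐞₁|) := by ring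
      _ ≤ K * σ := by gcongr
  set P : ℝ² → ℝ := fun v =>
    n x (sndDeriv R x 𝐞₁ 𝐞₁) * sndDeriv Ω x 𝐞₀ 𝐞₀ (fderiv ℝ R x v) N
      - 2 * n x (sndDeriv R x 𝐞₀ 𝐞₁) * sndDeriv Ω x 𝐞₀ 𝐞₁ (fderiv ℝ R x v) N
      + n x (sndDeriv R x 𝐞₀ 𝐞₀) * sndDeriv Ω x 𝐞₁ 𝐞₁ (fderiv ℝ R x v) N with hP
  have hPlin : P X = X 0 * P 𝐞₀ + X 1 * P 𝐞₁ := by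
    have : ∀ k i, sndDeriv Ω x k i (fderiv ℝ R x X) N =
        X 0 * sndDeriv Ω x k i (fderiv ℝ R x 𝐞₀) N
          + X 1 * sndDeriv Ω x k i (fderiv ℝ R x 𝐞₁) N := by
      intro k i
      conv_lhs => rw [plane_decomp X]
      simp
    simp only [hP, this]
    ring
  have hPK : ∀ m, |P (𝐞 m)| ≤ (4 * K + 12 * K ^ 2) * σ := by
    intro m
    set E : Fin 2 → Fin 2 → ℝ := fun k i =>
      -S (𝐞 k) (θ x (sndDeriv R x (𝐞 m) (𝐞 i))) + S (𝐞 m) (θ x (sndDeriv R x (𝐞 k) (𝐞 i)))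
        - S (𝐞 i) (θ x (sndDeriv R x (𝐞 k) (𝐞 m))) with hE
    have hEK : ∀ k i, |E k i| ≤ 3 * (K * σ) := by
      intro k i
      have e1 := abs_le.1 (hSK k m i)
      have e2 := abs_le.1 (hSK m k i)
      have e3 := abs_le.1 (hSK i k m)
      rw [hE, abs_le]
      constructor <;> dsimp only <;> linarith [e1.1, e1.2, e2.1, e2.2, e3.1, e3.2]
    have hO : ∀ k i, sndDeriv Ω x (𝐞 k) (𝐞 i) (fderiv ℝ R x (𝐞 m)) N =
        fderiv ℝ (fun y => fderiv ℝ Ω y (𝐞 k) (fderiv ℝ R y (𝐞 i)) N) x (𝐞 m) + E k i := by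
      intro k i
      rw [h.codazzi hx N, h.fderiv_apply_const hx hcx (𝐞 k) (sndDeriv R x _ _),
        h.fderiv_apply_const hx hcx (𝐞 m) (sndDeriv R x _ _),
        h.fderiv_apply_const hx hcx (𝐞 i) (sndDeriv R x _ _)]
      simp only [hE, hS]
      ring
    have htr := h.fderiv_trace hc hn hx (𝐞 m)
    have hPm : P (𝐞 m) =
        -(fderiv ℝ (fun y => n y (sndDeriv R y 𝐞₁ 𝐞₁)) x (𝐞 m) * S 𝐞₀ 𝐞₀
          - 2 * (fderiv ℝ (fun y => n y (sndDeriv R y 𝐞₀ 𝐞₁)) x (𝐞 m) * S 𝐞₀ 𝐞₁)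
          + fderiv ℝ (fun y => n y (sndDeriv R y 𝐞₀ 𝐞₀)) x (𝐞 m) * S 𝐞₁ 𝐞₁)
        + n x (sndDeriv R x 𝐞₁ 𝐞₁) * E 0 0 - 2 * (n x (sndDeriv R x 𝐞₀ 𝐞₁) * E 0 1)
        + n x (sndDeriv R x 𝐞₀ 𝐞₀) * E 1 1 := by
      rw [← htr]
      simp only [hP]
      rw [hO 0 0, hO 0 1, hO 1 1]
      ring
    have t1 := abs_le.1 (abs_mul_le_mul (hdHK 1 1 m) h00)
    have t2 := abs_le.1 (abs_mul_le_mul (hdHK 0 1 m) h01)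
    have t3 := abs_le.1 (abs_mul_le_mul (hdHK 0 0 m) h11)
    have t4 := abs_le.1 (abs_mul_le_mul (hHK 1 1) (hEK 0 0))
    have t5 := abs_le.1 (abs_mul_le_mul (hHK 0 1) (hEK 0 1))
    have t6 := abs_le.1 (abs_mul_le_mul (hHK 0 0) (hEK 1 1))
    rw [hPm, abs_le]
    constructor <;> linarith [t1.1, t1.2, t2.1, t2.2, t3.1, t3.2, t4.1, t4.2, t5.1, t5.2,
      t6.1, t6.2]
  have hSX := norm_mul_norm_le_of_trace_eq_zero hd hdet hH0 hH1
    ((le_abs_self _).trans (hHK 0 0)) ((le_abs_self _).trans (hHK 1 1))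
    (h.trace_eq_zero hx hcx) (X 0) (X 1)
  change σ * _ ≤ 18 * K ^ 6 / d ^ 3 * (|S 𝐞₀ 𝐞₀ * X 0 + S 𝐞₀ 𝐞₁ * X 1|
    + |S 𝐞₀ 𝐞₁ * X 0 + S 𝐞₁ 𝐞₁ * X 1|) at hSX
  have hS0 : S 𝐞₀ 𝐞₀ * X 0 + S 𝐞₀ 𝐞₁ * X 1 = S 𝐞₀ X := by rw [hSlin 𝐞₀ X]; ring
  have hS1 : S 𝐞₀ 𝐞₁ * X 0 + S 𝐞₁ 𝐞₁ * X 1 = S 𝐞₁ X := by rw [hSlin 𝐞₁ X, hS10]; ring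
  rw [hS0, hS1] at hSX
  change |P X| ≤ _
  calc |P X| ≤ |X 0 * P 𝐞₀| + |X 1 * P 𝐞₁| := by rw [hPlin]; exact abs_add_le _ _
    _ ≤ |X 0| * ((4 * K + 12 * K ^ 2) * σ) + |X 1| * ((4 * K + 12 * K ^ 2) * σ) :=
        add_le_add (abs_mul_le_mul le_rfl (hPK 0)) (abs_mul_le_mul le_rfl (hPK 1))
    _ = (4 * K + 12 * K ^ 2) * (σ * (|X 0| + |X 1|)) := by ring
    _ ≤ (4 * K + 12 * K ^ 2) * (18 * K ^ 6 / d ^ 3 * (|S 𝐞₀ X| + |S 𝐞₁ X|)) := by gcongr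
    _ ≤ (4 * K + 12 * K ^ 2) * (18 * K ^ 6 / d ^ 3 * (‖fderiv ℝ (fun y => Ω y w w') x‖
          + ‖fderiv ℝ (fun y => Ω y w w') x‖)) := by
        gcongr
        · exact hunorm 0
        · exact hunorm 1
    _ = _ := by ring

include hn in
/-- An entry of the rotation field of a convex surface that has a local maximum is locally
constant. -/
theorem eventually_eq_of_isLocalMax (hθ : ∀ x ∈ U, ContDiffAt ℝ ∞ θ x)
    (hpos : ∀ x ∈ U, ∀ v, v ≠ 0 → 0 < n x (sndDeriv R x v v)) {x₀ : ℝ²} (hx₀ : x₀ ∈ U) (w w' : W)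
    (hmax : IsLocalMax (fun y => Ω y w w') x₀) :
    ∀ᶠ y in 𝓝 x₀, Ω y w w' = Ω x₀ w w' := by
  have hHs : ∀ x ∈ U, ∀ i j, ContDiffAt ℝ ∞ (fun y => n y (sndDeriv R y i j)) x := fun x hx i j =>
    (hn x hx).clm_apply ((h.smooth_surface x hx).sndDeriv i j)
  obtain ⟨K₁, hK₁⟩ := exists_eventually_abs_le (x := x₀)
    (f := fun (a : Fin 2 × Fin 2) y => n y (sndDeriv R y (𝐞 a.1) (𝐞 a.2)))
    fun a => (hHs x₀ hx₀ _ _).continuousAt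
  obtain ⟨K₂, hK₂⟩ := exists_eventually_abs_le (x := x₀)
    (f := fun (a : (Fin 2 × Fin 2) × Fin 2) x =>
      fderiv ℝ (fun y => n y (sndDeriv R y (𝐞 a.1.1) (𝐞 a.1.2))) x (𝐞 a.2))
    fun a => ((hHs x₀ hx₀ _ _).fderiv_apply_const _).continuousAt
  obtain ⟨K₃, hK₃⟩ := exists_eventually_abs_le (x := x₀)
    (f := fun (a : (Fin 2 × Fin 2) × Fin 2) x => θ x (sndDeriv R x (𝐞 a.1.1) (𝐞 a.1.2)) a.2)
    fun a => by
      have h1 := ((hθ x₀ hx₀).clm_apply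
        ((h.smooth_surface x₀ hx₀).sndDeriv (𝐞 a.1.1) (𝐞 a.1.2))).continuousAt
      exact (EuclideanSpace.proj (𝕜 := ℝ) a.2).continuous.continuousAt.comp h1
  have hposx : ∀ x ∈ U, 0 < n x (sndDeriv R x 𝐞₀ 𝐞₀) ∧ 0 < n x (sndDeriv R x 𝐞₁ 𝐞₁) ∧
      0 < n x (sndDeriv R x 𝐞₀ 𝐞₀) * n x (sndDeriv R x 𝐞₁ 𝐞₁)
        - n x (sndDeriv R x 𝐞₀ 𝐞₁) ^ 2 := by
    intro x hx
    have h0 := hpos x hx 𝐞₀ (by simp)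
    have h1 := hpos x hx 𝐞₁ (by simp)
    refine ⟨h0, h1, ?_⟩
    set a := n x (sndDeriv R x 𝐞₀ 𝐞₀) with ha
    set b := n x (sndDeriv R x 𝐞₀ 𝐞₁) with hb
    set c := n x (sndDeriv R x 𝐞₁ 𝐞₁) with hcc
    have h2 := hpos x hx (-b • 𝐞₀ + a • 𝐞₁) (by
      intro h3
      have := congrArg (fun v : ℝ² => v 1) h3
      simp at this
      exact h0.ne' this)
    have h3 : n x (sndDeriv R x (-b • 𝐞₀ + a • 𝐞₁) (-b • 𝐞₀ + a • 𝐞₁)) = a * (a * c - b ^ 2) := by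
      have hs : n x (sndDeriv R x 𝐞₁ 𝐞₀) = b := by
        rw [hb, snd_fderiv_symm (h.smooth_surface x hx) 𝐞₁ 𝐞₀]
      have : n x (sndDeriv R x (-b • 𝐞₀ + a • 𝐞₁) (-b • 𝐞₀ + a • 𝐞₁)) =
          b ^ 2 * a - b * a * b - b * a * n x (sndDeriv R x 𝐞₁ 𝐞₀) + a ^ 2 * c := by
        simp only [sndDeriv, map_add, map_smul, add_apply, smul_apply, smul_eq_mul, hcc, hb, ha]
        ring
      rw [this, hs]; ring
    rw [h3] at h2
    exact (pos_iff_pos_of_mul_pos h2).1 h0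
  set d := (n x₀ (sndDeriv R x₀ 𝐞₀ 𝐞₀) * n x₀ (sndDeriv R x₀ 𝐞₁ 𝐞₁)
        - n x₀ (sndDeriv R x₀ 𝐞₀ 𝐞₁) ^ 2) / 2 with hd
  have hdpos : 0 < d := half_pos (hposx x₀ hx₀).2.2
  have hdev : ∀ᶠ x in 𝓝 x₀, d < n x (sndDeriv R x 𝐞₀ 𝐞₀) * n x (sndDeriv R x 𝐞₁ 𝐞₁)
        - n x (sndDeriv R x 𝐞₀ 𝐞₁) ^ 2 := by
    have hcont : ContinuousAt (fun x => n x (sndDeriv R x 𝐞₀ 𝐞₀) * n x (sndDeriv R x 𝐞₁ 𝐞₁)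
        - n x (sndDeriv R x 𝐞₀ 𝐞₁) ^ 2) x₀ :=
      ((hHs x₀ hx₀ _ _).continuousAt.mul (hHs x₀ hx₀ _ _).continuousAt).sub
        ((hHs x₀ hx₀ _ _).continuousAt.pow 2)
    exact hcont.eventually (lt_mem_nhds (half_lt_self (hposx x₀ hx₀).2.2))
  set K := max K₁ (max K₂ K₃) with hK
  have hev := (h.isOpen.eventually_mem hx₀).and
    (hK₁.and (hK₂.and (hK₃.and (hdev.and hmax))))
  obtain ⟨r, hr, hball⟩ := Metric.eventually_nhds_iff_ball.1 hev
  have hK1K : K₁ ≤ K := le_max_left _ _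
  have hK2K : K₂ ≤ K := (le_max_left _ _).trans (le_max_right _ _)
  have hK3K : K₃ ≤ K := (le_max_right _ _).trans (le_max_right _ _)
  have hKpos : 0 < K :=
    ((hposx x₀ hx₀).1.trans_le (le_abs_self _)).trans_le
      (((hball x₀ (mem_ball_self hr)).2.1 (0, 0)).trans hK1K)
  refine strong_maximum_principle (u := fun y => Ω y w w') hr
    (a := fun x => n x (sndDeriv R x 𝐞₁ 𝐞₁)) (b := fun x => -n x (sndDeriv R x 𝐞₀ 𝐞₁))
    (c := fun x => n x (sndDeriv R x 𝐞₀ 𝐞₀)) (lam := d / (2 * K)) (Lam := K + K)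
    (C := (4 * K + 12 * K ^ 2) * (18 * K ^ 6 / d ^ 3 * 2)) (by positivity) (by positivity)
    (fun x hx => ?_) (fun x hx ξ η => ?_) (fun x hx => ?_) (fun x hx => ?_) (fun x hx => ?_)
  · exact (h.contDiffAt_entry (hball x hx).1 w w').of_le (by norm_cast)
  · obtain ⟨hxU, h1, -, -, h4, -⟩ := hball x hx
    exact quadratic_lower_bound hdpos h4.le (hposx x hxU).1 (hposx x hxU).2.1
      ((le_abs_self _).trans ((h1 (0, 0)).trans hK1K))
      ((le_abs_self _).trans ((h1 (1, 1)).trans hK1K)) ξ η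
  · obtain ⟨hxU, h1, -, -, h4, -⟩ := hball x hx
    exact add_le_add ((le_abs_self _).trans ((h1 (1, 1)).trans hK1K))
      ((le_abs_self _).trans ((h1 (0, 0)).trans hK1K))
  · obtain ⟨hxU, h1, h2, h3, h4, -⟩ := hball x hx
    exact h.abs_planeOperator_entry_le hc hn hxU hdpos h4.le (hposx x hxU).1 (hposx x hxU).2.1
      (fun i j => (h1 (i, j)).trans hK1K) (fun i j k => (h2 ((i, j), k)).trans hK2K)
      (fun i j k => (h3 ((i, j), k)).trans hK3K) w w'
  · exact (hball x hx).2.2.2.2.2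

end IsRotationField

/-- A convex parametrized surface `R` with conormal `n`, and the covector field `T` of an
infinitesimal isometric deformation. -/
structure IsDeformedConvexPatch (U : Set ℝ²) (R : ℝ² → W) (T n : ℝ² → W →L[ℝ] ℝ) : Prop where
  isOpen : IsOpen U
  smooth_surface : ∀ x ∈ U, ContDiffAt ℝ ∞ R x
  smooth_field : ∀ x ∈ U, ContDiffAt ℝ ∞ T x
  smooth_conormal : ∀ x ∈ U, ContDiffAt ℝ ∞ n x
  independent : ∀ x ∈ U, ∀ (c : ℝ) v, c • R x + fderiv ℝ R x v = 0 → c = 0 ∧ v = 0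
  field_point : ∀ x ∈ U, T x (R x) = 0
  field_tangent : ∀ x ∈ U, ∀ v w,
    fderiv ℝ T x v (fderiv ℝ R x w) + fderiv ℝ T x w (fderiv ℝ R x v) = 0
  conormal_point : ∀ x ∈ U, n x (R x) = 0
  conormal_tangent : ∀ x ∈ U, ∀ v, n x (fderiv ℝ R x v) = 0
  convex : ∀ x ∈ U, ∀ v, v ≠ 0 → 0 < fderiv ℝ n x v (fderiv ℝ R x v)

namespace IsDeformedConvexPatch

variable {U : Set ℝ²} {R : ℝ² → W} {T n : ℝ² → W →L[ℝ] ℝ} (h : IsDeformedConvexPatch U R T n)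

include h

theorem conormal_sndDeriv_neg {x : ℝ²} (hx : x ∈ U) {v : ℝ²} (hv : v ≠ 0) :
    n x (sndDeriv R x v v) < 0 := by
  have h2 := fderiv_clm_apply_apply (h.smooth_conormal x hx)
    ((h.smooth_surface x hx).fderiv_apply_const v) v
  have h3 : (fun y => n y (fderiv ℝ R y v)) =ᶠ[𝓝 x] fun _ => 0 := by
    filter_upwards [h.isOpen.mem_nhds hx] with y hy using h.conormal_tangent y hy v
  rw [h3.fderiv_eq, fderiv_fderiv_apply_const (h.smooth_surface x hx)] at h2
  simp only [fderiv_fun_const, Pi.zero_apply, zero_apply] at h2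
  linarith [h.convex x hx v hv]

theorem field_tangent_point {x : ℝ²} (hx : x ∈ U) (v : ℝ²) :
    fderiv ℝ T x v (R x) = -T x (fderiv ℝ R x v) := by
  have h2 := fderiv_clm_apply_apply (h.smooth_field x hx) (h.smooth_surface x hx) v
  have h3 : (fun y => T y (R y)) =ᶠ[𝓝 x] fun _ => 0 := by
    filter_upwards [h.isOpen.mem_nhds hx] with y hy using h.field_point y hy
  rw [h3.fderiv_eq] at h2
  simp only [fderiv_fun_const, Pi.zero_apply, zero_apply] at h2
  linarith

/-- Locally, the rotation field of an infinitesimal isometric deformation exists, is unique and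
smooth, and its entries satisfy the strong maximum principle. -/
theorem exists_rotationField [FiniteDimensional ℝ W] (hW : Module.finrank ℝ W = 4)
    {x₀ : ℝ²} (hx₀ : x₀ ∈ U) :
    ∃ V ⊆ U, ∃ Ω : ℝ² → W →L[ℝ] W →L[ℝ] ℝ, IsOpen V ∧ x₀ ∈ V ∧
      (∀ x ∈ V, ContDiffAt ℝ ∞ Ω x) ∧
      (∀ x ∈ V, ∀ Ω' : W →L[ℝ] W →L[ℝ] ℝ,
        (IsSkewForm Ω' ∧ Ω' (R x) = T x ∧ ∀ v, Ω' (fderiv ℝ R x v) = fderiv ℝ T x v) ↔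
          Ω' = Ω x) ∧
      ∀ x ∈ V, ∀ w w', IsLocalMax (fun y => Ω y w w') x →
        ∀ᶠ y in 𝓝 x, Ω y w w' = Ω x w w' := by
  set N := sndDeriv R x₀ 𝐞₀ 𝐞₀ with hN
  set V := U ∩ (fun x => n x N) ⁻¹' Set.Iio 0 with hV
  have hVU : V ⊆ U := Set.inter_subset_left
  have hVo : IsOpen V := ContinuousOn.isOpen_inter_preimage
    (fun x hx => ((h.smooth_conormal x hx).clm_apply
      contDiffAt_const).continuousAt.continuousWithinAt) h.isOpen isOpen_Iio
  have hx₀V : x₀ ∈ V := ⟨hx₀, h.conormal_sndDeriv_neg hx₀ (by simp)⟩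
  have hnN : ∀ x ∈ V, n x N < 0 := fun x hx => hx.2
  have hRV : ∀ x ∈ V, ContDiffAt ℝ ∞ R x := fun x hx => h.smooth_surface x (hVU hx)
  have hTV : ∀ x ∈ V, ContDiffAt ℝ ∞ T x := fun x hx => h.smooth_field x (hVU hx)
  obtain ⟨ρ, θ, n', hρ, hθ, hn', hc⟩ := exists_smooth_dualCoframe hW hRV
    (fun x hx => h.independent x (hVU hx)) (fun x hx => h.conormal_point x (hVU hx))
    (fun x hx => h.conormal_tangent x (hVU hx)) (fun x hx => (hnN x hx).ne)
  set Ω : ℝ² → W →L[ℝ] W →L[ℝ] ℝ := fun x =>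
    rotationForm (T x) (fderiv ℝ T x) N (ρ x) (θ x) (n' x) with hΩ
  have hΩs : ∀ x ∈ V, ContDiffAt ℝ ∞ Ω x := by
    intro x hx
    have hT := hTV x hx
    have hT' : ContDiffAt ℝ ∞ (fderiv ℝ T) x := hT.fderiv_right (by simp)
    exact (((hρ x hx).smulRight hT).add (hT'.clm_comp (hθ x hx))).sub
      ((hn' x hx).smulRight (((hT.clm_apply contDiffAt_const).smul (hρ x hx)).add
        ((contDiffAt_const.clm_comp hT').clm_comp (hθ x hx))))
  have hskew : ∀ x ∈ V, IsSkewForm (Ω x) := fun x hx =>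
    (hc x hx).isSkewForm_rotationForm (h.field_point x (hVU hx))
      (h.field_tangent_point (hVU hx)) (h.field_tangent x (hVU hx))
  have hΩR : ∀ x ∈ V, Ω x (R x) = T x := fun x hx => (hc x hx).rotationForm_point
  have hΩT : ∀ x ∈ V, ∀ v, Ω x (fderiv ℝ R x v) = fderiv ℝ T x v := fun x hx v =>
    (hc x hx).rotationForm_tangent v
  have hrot := isRotationField_of_values hVo hRV hTV hΩs hskew hΩR hΩT
  refine ⟨V, hVU, Ω, hVo, hx₀V, hΩs, fun x hx Ω' => ⟨fun ⟨h1, h2, h3⟩ => ?_, ?_⟩,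
    fun x hx w w' hmax => ?_⟩
  · exact (hc x hx).ext_skewForm h1 (hskew x hx) (h2.trans (hΩR x hx).symm)
      fun v => (h3 v).trans (hΩT x hx v).symm
  · rintro rfl
    exact ⟨hskew x hx, hΩR x hx, hΩT x hx⟩
  · refine hrot.eventually_eq_of_isLocalMax hc hn' hθ (fun y hy v hv => ?_) hx w w' hmax
    have h1 : n y (sndDeriv R y v v) = n' y (sndDeriv R y v v) * n y N := by
      conv_lhs => rw [(hc y hy).decomp (sndDeriv R y v v)]
      simp [h.conormal_point y (hVU hy), h.conormal_tangent y (hVU hy)]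
    have h2 := h.conormal_sndDeriv_neg (hVU hy) hv
    rw [h1] at h2
    exact pos_of_mul_neg_left h2 (hnN y hy).le

end IsDeformedConvexPatch

section Manifold

variable {M : Type*} [TopologicalSpace M] [ChartedSpace (EuclideanSpace ℝ (Fin 2)) M]

/-- A convex surface `R` in a vector space with conormal `n`, and the covector field `T` of an
infinitesimal isometric deformation. -/
structure IsDeformedConvexSurface (R : M → W) (T n : M → W →L[ℝ] ℝ) : Prop where
  smooth_surface : ContMDiff (𝓡 2) 𝓘(ℝ, W) ∞ R
  smooth_field : ContMDiff (𝓡 2) 𝓘(ℝ, W →L[ℝ] ℝ) ∞ T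
  smooth_conormal : ContMDiff (𝓡 2) 𝓘(ℝ, W →L[ℝ] ℝ) ∞ n
  independent : ∀ p, ∀ (c : ℝ) (v : TangentSpace (𝓡 2) p),
    c • R p + mvfderiv (𝓡 2) R p v = 0 → c = 0 ∧ v = 0
  field_point : ∀ p, T p (R p) = 0
  field_tangent : ∀ p, ∀ v w : TangentSpace (𝓡 2) p,
    mvfderiv (𝓡 2) T p v (mvfderiv (𝓡 2) R p w)
      + mvfderiv (𝓡 2) T p w (mvfderiv (𝓡 2) R p v) = 0
  conormal_point : ∀ p, n p (R p) = 0
  conormal_tangent : ∀ p, ∀ v : TangentSpace (𝓡 2) p, n p (mvfderiv (𝓡 2) R p v) = 0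
  convex : ∀ p, ∀ v : TangentSpace (𝓡 2) p, v ≠ 0 →
    0 < mvfderiv (𝓡 2) n p v (mvfderiv (𝓡 2) R p v)

variable [IsManifold (𝓡 2) ∞ M]

theorem contDiffAt_comp_extChartAt_symm {F : Type*} [NormedAddCommGroup F] [NormedSpace ℝ F]
    {f : M → F} (hf : ContMDiff (𝓡 2) 𝓘(ℝ, F) ∞ f) (p : M) {x : ℝ²}
    (hx : x ∈ (extChartAt (𝓡 2) p).target) :
    ContDiffAt ℝ ∞ (f ∘ (extChartAt (𝓡 2) p).symm) x := by
  have h1 : ContMDiffAt 𝓘(ℝ, ℝ²) (𝓡 2) ∞ (extChartAt (𝓡 2) p).symm x :=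
    (contMDiffOn_extChartAt_symm p).contMDiffAt
      ((isOpen_extChartAt_target p).mem_nhds hx)
  exact (hf.contMDiffAt.comp x h1).contDiffAt

theorem fderiv_comp_extChartAt_symm {F : Type*} [NormedAddCommGroup F] [NormedSpace ℝ F]
    {f : M → F} (hf : ContMDiff (𝓡 2) 𝓘(ℝ, F) ∞ f) (p : M) {x : ℝ²}
    (hx : x ∈ (extChartAt (𝓡 2) p).target) (v : ℝ²) :
    fderiv ℝ (f ∘ (extChartAt (𝓡 2) p).symm) x v =
      mvfderiv (𝓡 2) f ((extChartAt (𝓡 2) p).symm x)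
        (mfderiv 𝓘(ℝ, ℝ²) (𝓡 2) (extChartAt (𝓡 2) p).symm x v) := by
  have h1 : ContMDiffAt 𝓘(ℝ, ℝ²) (𝓡 2) ∞ (extChartAt (𝓡 2) p).symm x :=
    (contMDiffOn_extChartAt_symm p).contMDiffAt
      ((isOpen_extChartAt_target p).mem_nhds hx)
  have h2 := mfderiv_comp_apply x (hf.contMDiffAt.mdifferentiableAt (by simp))
    (h1.mdifferentiableAt (by simp)) v
  rw [mfderiv_eq_fderiv] at h2
  exact h2

theorem bijective_mfderiv_extChartAt_symm (p : M) {x : ℝ²}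
    (hx : x ∈ (extChartAt (𝓡 2) p).target) :
    Function.Bijective (mfderiv 𝓘(ℝ, ℝ²) (𝓡 2) (extChartAt (𝓡 2) p).symm x) := by
  have h := isInvertible_mfderivWithin_extChartAt_symm (I := 𝓡 2) (x := p) hx
  simp only [modelWithCornersSelf_coe, Set.range_id, mfderivWithin_univ] at h
  exact h.bijective

namespace IsDeformedConvexSurface

variable {R : M → W} {T n : M → W →L[ℝ] ℝ} (h : IsDeformedConvexSurface R T n)

include h

theorem isDeformedConvexPatch (p : M) :
    IsDeformedConvexPatch (extChartAt (𝓡 2) p).target (R ∘ (extChartAt (𝓡 2) p).symm)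
      (T ∘ (extChartAt (𝓡 2) p).symm) (n ∘ (extChartAt (𝓡 2) p).symm) where
  isOpen := isOpen_extChartAt_target p
  smooth_surface x hx := contDiffAt_comp_extChartAt_symm h.smooth_surface p hx
  smooth_field x hx := contDiffAt_comp_extChartAt_symm h.smooth_field p hx
  smooth_conormal x hx := contDiffAt_comp_extChartAt_symm h.smooth_conormal p hx
  independent x hx c v hcv := by
    rw [fderiv_comp_extChartAt_symm h.smooth_surface p hx] at hcv
    obtain ⟨hc, hv⟩ := h.independent _ c _ hcv
    exact ⟨hc, (bijective_mfderiv_extChartAt_symm p hx).1 (hv.trans (map_zero _).symm)⟩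
  field_point x _ := h.field_point _
  field_tangent x hx v w := by
    simp only [fderiv_comp_extChartAt_symm h.smooth_surface p hx,
      fderiv_comp_extChartAt_symm h.smooth_field p hx]
    exact h.field_tangent _ _ _
  conormal_point x _ := h.conormal_point _
  conormal_tangent x hx v := by
    rw [fderiv_comp_extChartAt_symm h.smooth_surface p hx]
    exact h.conormal_tangent _ _
  convex x hx v hv := by
    rw [fderiv_comp_extChartAt_symm h.smooth_surface p hx,
      fderiv_comp_extChartAt_symm h.smooth_conormal p hx]
    exact h.convex _ _ fun h0 =>
      hv ((bijective_mfderiv_extChartAt_symm p hx).1 (h0.trans (map_zero _).symm))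

/-- An infinitesimal isometric deformation of a compact convex surface is given by a constant
infinitesimal rotation. -/
theorem exists_isSkewForm [FiniteDimensional ℝ W] (hW : Module.finrank ℝ W = 4)
    [CompactSpace M] [ConnectedSpace M] :
    ∃ Ω : W →L[ℝ] W →L[ℝ] ℝ, IsSkewForm Ω ∧ ∀ p, Ω (R p) = T p := by
  -- the rotation field, chart by chart
  have hloc : ∀ p : M, ∃ V : Set M, ∃ Ωp : M → W →L[ℝ] W →L[ℝ] ℝ, IsOpen V ∧ p ∈ V ∧
      ContinuousAt Ωp p ∧
      (∀ q ∈ V, ∀ Ω' : W →L[ℝ] W →L[ℝ] ℝ,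
        (IsSkewForm Ω' ∧ Ω' (R q) = T q ∧
          ∀ v : TangentSpace (𝓡 2) q, Ω' (mvfderiv (𝓡 2) R q v) = mvfderiv (𝓡 2) T q v) ↔
          Ω' = Ωp q) ∧
      ∀ w w', IsLocalMax (fun q => Ωp q w w') p → ∀ᶠ q in 𝓝 p, Ωp q w w' = Ωp p w w' := by
    intro p
    set φ := extChartAt (𝓡 2) p with hφ
    obtain ⟨V, hVU, Ω, hVo, hpV, hΩs, huniq, hmax⟩ :=
      (h.isDeformedConvexPatch p).exists_rotationField hW (mem_extChartAt_target (I := 𝓡 2) p)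
    rw [← hφ] at hpV huniq
    have hφc : ContinuousAt φ p := continuousAt_extChartAt p
    have hψc : ContinuousAt φ.symm (φ p) := continuousAt_extChartAt_symm p
    have hψp : φ.symm (φ p) = p := extChartAt_to_inv p
    refine ⟨φ.source ∩ φ ⁻¹' V, Ω ∘ φ, ?_, ⟨mem_extChartAt_source p, hpV⟩, ?_, ?_, ?_⟩
    · exact (continuousOn_extChartAt p).isOpen_inter_preimage (isOpen_extChartAt_source p) hVo
    · exact (hΩs _ hpV).continuousAt.comp hφc
    · rintro q ⟨hqs, hqV⟩ Ω'
      have hq : φ.symm (φ q) = q := φ.left_inv hqs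
      have hqt : φ q ∈ φ.target := φ.map_source hqs
      rw [Function.comp_apply, ← huniq (φ q) hqV Ω']
      obtain ⟨A, hA, e1, e2⟩ : ∃ A : ℝ² → TangentSpace (𝓡 2) q, Function.Surjective A ∧
          (∀ v, fderiv ℝ (R ∘ φ.symm) (φ q) v = mvfderiv (𝓡 2) R q (A v)) ∧
          ∀ v, fderiv ℝ (T ∘ φ.symm) (φ q) v = mvfderiv (𝓡 2) T q (A v) := by
        have key : ∀ q', φ.symm (φ q) = q' → ∃ A : ℝ² → TangentSpace (𝓡 2) q',
            Function.Surjective A ∧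
            (∀ v, fderiv ℝ (R ∘ φ.symm) (φ q) v = mvfderiv (𝓡 2) R q' (A v)) ∧
            ∀ v, fderiv ℝ (T ∘ φ.symm) (φ q) v = mvfderiv (𝓡 2) T q' (A v) := by
          rintro _ rfl
          exact ⟨_, (bijective_mfderiv_extChartAt_symm p hqt).2,
            fderiv_comp_extChartAt_symm h.smooth_surface p hqt,
            fderiv_comp_extChartAt_symm h.smooth_field p hqt⟩
        exact key q hq
      simp only [Function.comp_apply, hq, e1, e2]
      refine and_congr_right fun _ => and_congr_right fun _ => ⟨fun h1 v => h1 _, fun h1 v => ?_⟩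
      obtain ⟨v, rfl⟩ := hA v
      exact h1 v
    · intro w w' hlm
      have h1 : IsLocalMax (fun x => Ω x w w') (φ p) := by
        have h2 := hψc.eventually (p := fun q => Ω (φ q) w w' ≤ Ω (φ p) w w')
          (by rw [hψp]; exact hlm)
        filter_upwards [h2, (isOpen_extChartAt_target p).mem_nhds
          (mem_extChartAt_target (I := 𝓡 2) p)] with x hx hxt
        rwa [φ.right_inv hxt] at hx
      exact hφc.eventually (hmax _ hpV w w' h1)
  choose V Ωl hVo hpV hcont huniq hmax using hloc
  set Ω : M → W →L[ℝ] W →L[ℝ] ℝ := fun p => Ωl p p with hΩ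
  have hΩV : ∀ p, ∀ q ∈ V p, Ω q = Ωl p q := fun p q hq =>
    (huniq p q hq _).1 ((huniq q q (hpV q) _).2 rfl)
  have hΩev : ∀ p, Ω =ᶠ[𝓝 p] Ωl p := fun p => by
    filter_upwards [(hVo p).mem_nhds (hpV p)] with q hq using hΩV p q hq
  have hΩc : Continuous Ω := continuous_iff_continuousAt.2 fun p =>
    (hcont p).congr (hΩev p).symm
  have hconst : ∀ w w', ∃ c, ∀ p, Ω p w w' = c := by
    intro w w'
    have huc : Continuous fun p => Ω p w w' :=
      (hΩc.clm_apply continuous_const).clm_apply continuous_const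
    obtain ⟨p₀, -, hp₀⟩ := isCompact_univ.exists_isMaxOn Set.univ_nonempty huc.continuousOn
    have hle : ∀ q, Ω q w w' ≤ Ω p₀ w w' := fun q => hp₀ (Set.mem_univ q)
    have hclopen : IsClopen {q | Ω q w w' = Ω p₀ w w'} := by
      refine ⟨isClosed_eq huc continuous_const, isOpen_iff_mem_nhds.2 fun q hq => ?_⟩
      have h1 : IsLocalMax (fun y => Ωl q y w w') q := by
        filter_upwards [hΩev q] with y hy
        rw [← hy, ← (hΩev q).eq_of_nhds]
        exact (hle y).trans_eq hq.symm
      filter_upwards [hmax q w w' h1, hΩev q] with y hy hy'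
      rw [hy', hy, ← (hΩev q).eq_of_nhds]
      exact hq
    have huniv := hclopen.eq_univ ⟨p₀, rfl⟩
    exact ⟨_, fun p => (huniv ▸ Set.mem_univ p : p ∈ {q | Ω q w w' = Ω p₀ w w'})⟩
  obtain ⟨p₀⟩ : Nonempty M := inferInstance
  refine ⟨Ω p₀, ((huniq p₀ p₀ (hpV p₀) _).2 rfl).1, fun p => ?_⟩
  have heq : Ω p₀ = Ω p := by
    ext w w'
    obtain ⟨c, hc⟩ := hconst w w'
    rw [hc, hc]
  rw [heq]
  exact ((huniq p p (hpV p) _).2 rfl).2.1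

end IsDeformedConvexSurface

end Manifold

end Surfaces

section Calculus

variable {M : Type*} [TopologicalSpace M] [ChartedSpace (EuclideanSpace ℝ (Fin 2)) M]
  {F G H : Type*} [NormedAddCommGroup F] [NormedSpace ℝ F] [NormedAddCommGroup G]
  [NormedSpace ℝ G] [NormedAddCommGroup H] [NormedSpace ℝ H]

theorem mvfderiv_comp_eq_fderiv {g : F → G} {f : M → F} {p : M}
    (hg : DifferentiableAt ℝ g (f p)) (hf : MDifferentiableAt (𝓡 2) 𝓘(ℝ, F) f p)
    (v : TangentSpace (𝓡 2) p) :
    mvfderiv (𝓡 2) (fun q => g (f q)) p v = fderiv ℝ g (f p) (mvfderiv (𝓡 2) f p v) := by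
  have h := mfderiv_comp_apply p hg.mdifferentiableAt hf v
  rw [mfderiv_eq_fderiv] at h
  exact h

theorem mvfderiv_clm_comp (L : F →L[ℝ] G) {f : M → F} {p : M}
    (hf : MDifferentiableAt (𝓡 2) 𝓘(ℝ, F) f p) (v : TangentSpace (𝓡 2) p) :
    mvfderiv (𝓡 2) (fun q => L (f q)) p v = L (mvfderiv (𝓡 2) f p v) := by
  rw [mvfderiv_comp_eq_fderiv L.differentiableAt hf, L.fderiv]

theorem mvfderiv_bilinear (B : F →L[ℝ] G →L[ℝ] H) {f : M → F} {g : M → G} {p : M}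
    (hf : MDifferentiableAt (𝓡 2) 𝓘(ℝ, F) f p) (hg : MDifferentiableAt (𝓡 2) 𝓘(ℝ, G) g p)
    (v : TangentSpace (𝓡 2) p) :
    mvfderiv (𝓡 2) (fun q => B (f q) (g q)) p v =
      B (mvfderiv (𝓡 2) f p v) (g p) + B (f p) (mvfderiv (𝓡 2) g p v) := by
  have hfg : MDifferentiableAt (𝓡 2) 𝓘(ℝ, F × G) (fun q => (f q, g q)) p := hf.prodMk_space hg
  have hB : DifferentiableAt ℝ (fun z : F × G => B z.1 z.2) (f p, g p) :=
    B.isBoundedBilinearMap.differentiableAt (f p, g p)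
  rw [mvfderiv_comp_eq_fderiv (f := fun q => (f q, g q)) hB hfg v,
    (B.isBoundedBilinearMap.hasFDerivAt (f p, g p)).fderiv]
  have h1 := mvfderiv_clm_comp (ContinuousLinearMap.fst ℝ F G) hfg v
  have h2 := mvfderiv_clm_comp (ContinuousLinearMap.snd ℝ F G) hfg v
  simp only [ContinuousLinearMap.coe_fst', ContinuousLinearMap.coe_snd'] at h1 h2
  rw [h1, h2, IsBoundedBilinearMap.deriv_apply]
  exact add_comm _ _

theorem mvfderiv_apply_const {f : M → F →L[ℝ] G} {p : M}
    (hf : MDifferentiableAt (𝓡 2) 𝓘(ℝ, F →L[ℝ] G) f p) (v : TangentSpace (𝓡 2) p) (w : F) :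
    mvfderiv (𝓡 2) f p v w = mvfderiv (𝓡 2) (fun q => f q w) p v :=
  (mvfderiv_clm_comp (ContinuousLinearMap.apply ℝ G w) hf v).symm

theorem mvfderiv_const_apply (c : F) {p : M} (v : TangentSpace (𝓡 2) p) :
    mvfderiv (𝓡 2) (fun _ : M => c) p v = 0 := by
  simp [mvfderiv, mfderiv_const]

end Calculus

section Flow

variable {V : Type*} [NormedAddCommGroup V] [NormedSpace ℝ V]

/-- The one-parameter group of linear maps generated by `A`. -/
noncomputable def linearFlow (A : V →L[ℝ] V) (t : ℝ) : V →L[ℝ] V := NormedSpace.exp (t • A)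

theorem linearFlow_zero (A : V →L[ℝ] V) (x : V) : linearFlow A 0 x = x := by
  simp [linearFlow, NormedSpace.exp_zero]

variable [FiniteDimensional ℝ V]

theorem linearFlow_add (A : V →L[ℝ] V) (s t : ℝ) (x : V) :
    linearFlow A (s + t) x = linearFlow A s (linearFlow A t x) := by
  have : CompleteSpace V := FiniteDimensional.complete ℝ V
  let : NormedAlgebra ℚ (V →L[ℝ] V) := NormedAlgebra.restrictScalars ℚ ℝ _
  rw [linearFlow, add_smul, NormedSpace.exp_add_of_commute
    (((Commute.refl A).smul_left s).smul_right t)]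
  rfl

theorem hasDerivAt_linearFlow (A : V →L[ℝ] V) (x : V) (t : ℝ) :
    HasDerivAt (fun t => linearFlow A t x) (A (linearFlow A t x)) t := by
  have : CompleteSpace V := FiniteDimensional.complete ℝ V
  have h := (hasDerivAt_exp_smul_const' (𝕂 := ℝ) A t).clm_apply (hasDerivAt_const t x)
  simpa [linearFlow] using h

theorem linearFlow_invariant {A : V →L[ℝ] V} {B : V →L[ℝ] V →L[ℝ] ℝ}
    (hA : ∀ x y, B (A x) y + B x (A y) = 0) (x y : V) (t : ℝ) :
    B (linearFlow A t x) (linearFlow A t y) = B x y := by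
  have hd : ∀ t, HasDerivAt (fun t => B (linearFlow A t x) (linearFlow A t y)) 0 t := by
    intro t
    have h := (B.hasFDerivAt.comp_hasDerivAt t (hasDerivAt_linearFlow A x t)).clm_apply
      (hasDerivAt_linearFlow A y t)
    exact h.congr_deriv (hA _ _)
  have h0 := is_const_of_deriv_eq_zero (fun t => (hd t).differentiableAt)
    (fun t => (hd t).deriv) t 0
  simpa [linearFlow_zero] using h0

theorem exists_generator {B : V →L[ℝ] V →L[ℝ] ℝ} (hB : ∀ x, B x = 0 → x = 0) {G : Type*}
    [NormedAddCommGroup G] [NormedSpace ℝ G] [FiniteDimensional ℝ G] (Ω : G →L[ℝ] V →L[ℝ] ℝ) :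
    ∃ A : G →L[ℝ] V, ∀ x, B (A x) = Ω x := by
  have hdim : Module.finrank ℝ V = Module.finrank ℝ (V →L[ℝ] ℝ) := by
    rw [← (LinearMap.toContinuousLinearMap : (V →ₗ[ℝ] ℝ) ≃ₗ[ℝ] (V →L[ℝ] ℝ)).finrank_eq]
    exact Subspace.dual_finrank_eq.symm
  have hinj : Function.Injective (B : V →ₗ[ℝ] (V →L[ℝ] ℝ)) :=
    (injective_iff_map_eq_zero _).2 hB
  set e := LinearEquiv.ofInjectiveOfFinrankEq (B : V →ₗ[ℝ] (V →L[ℝ] ℝ)) hinj hdim with he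
  refine ⟨LinearMap.toContinuousLinearMap (e.symm.toLinearMap ∘ₗ (Ω : G →ₗ[ℝ] (V →L[ℝ] ℝ))),
    fun x => ?_⟩
  exact e.apply_symm_apply (Ω x)

end Flow

namespace AmbientModel

variable {V : Type*} [NormedAddCommGroup V] [NormedSpace ℝ V] (S : AmbientModel V)

theorem mem_isometryLieAlgebra_of_flow (φ : ℝ → V → V)
    (hmaps : ∀ t, ∀ x ∈ S.carrier, φ t x ∈ S.carrier)
    (hzero : ∀ x ∈ S.carrier, φ 0 x = x)
    (hadd : ∀ s t, ∀ x ∈ S.carrier, φ (s + t) x = φ s (φ t x))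
    (hform : ∀ t, ∀ x ∈ S.carrier, ∀ y ∈ S.carrier,
      S.form (φ t x - φ t y) (φ t x - φ t y) = S.form (x - y) (x - y))
    {X : S.carrier → V} (hX : ∀ x : S.carrier, HasDerivAt (fun t => φ t x) (X x) 0) :
    X ∈ S.isometryLieAlgebra := by
  have hinv : ∀ t, ∀ x ∈ S.carrier, φ (-t) (φ t x) = x := fun t x hx => by
    rw [← hadd _ _ x hx, neg_add_cancel, hzero x hx]
  have hinv' : ∀ t, ∀ x ∈ S.carrier, φ t (φ (-t) x) = x := fun t x hx => by
    rw [← hadd _ _ x hx, add_neg_cancel, hzero x hx]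
  refine ⟨fun t => ⟨⟨fun x => ⟨φ t x, hmaps t x x.2⟩, fun x => ⟨φ (-t) x, hmaps (-t) x x.2⟩,
    fun x => Subtype.ext (hinv t x x.2), fun x => Subtype.ext (hinv' t x x.2)⟩,
    fun x y => hform t x x.2 y y.2⟩, fun s t => ?_, hX⟩
  apply Subtype.ext
  ext x
  exact hadd s t x x.2

variable {S} in
theorem form_sub_eq_zero_of_mem (hsymm : ∀ x y, S.form x y = S.form y x) {X : S.carrier → V}
    (hX : X ∈ S.isometryLieAlgebra) (x y : S.carrier) :
    S.form (X x - X y) ((x : V) - y) = 0 := by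
  obtain ⟨φ, hadd, hφ⟩ := hX
  have h0 : φ 0 = 1 := by
    have := hadd 0 0
    rw [add_zero] at this
    exact left_eq_mul.1 this
  have hd := (hφ x).sub (hφ y)
  have h1 := (S.form.hasFDerivAt.comp_hasDerivAt (0 : ℝ) hd).clm_apply hd
  have h2 : HasDerivAt (fun _ : ℝ => S.form ((x : V) - y) ((x : V) - y)) 0 0 :=
    hasDerivAt_const _ _
  have h3 := h1.unique (h2.congr_of_eventuallyEq
    (Eventually.of_forall fun t => (φ t).2 x y))
  simp only [Function.comp_apply, h0, Pi.sub_apply, Subgroup.coe_one, Equiv.Perm.coe_one,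
    id_eq] at h3
  rw [hsymm ((x : V) - y)] at h3
  have h4 : S.form (X x - X y) ((x : V) - y) + S.form (X x - X y) ((x : V) - y) = 0 := h3
  linarith

variable {S} {M : Type*} [TopologicalSpace M] [ChartedSpace (EuclideanSpace ℝ (Fin 2)) M]

theorem solvesLinearized_of_mem (hsymm : ∀ x y, S.form x y = S.form y x) {r : M → S.carrier}
    {τ : M → V} (hr : ContMDiff (𝓡 2) 𝓘(ℝ, V) ∞ (S.position r))
    (hτ : ContMDiff (𝓡 2) 𝓘(ℝ, V) ∞ τ) {X : S.carrier → V} (hX : X ∈ S.isometryLieAlgebra)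
    (hτX : ∀ p, τ p = X (r p)) : S.SolvesLinearized r τ := by
  have hrd : ∀ p, MDifferentiableAt (𝓡 2) 𝓘(ℝ, V) (S.position r) p := fun p =>
    hr.contMDiffAt.mdifferentiableAt (by simp)
  have hτd : ∀ p, MDifferentiableAt (𝓡 2) 𝓘(ℝ, V) τ p := fun p =>
    hτ.contMDiffAt.mdifferentiableAt (by simp)
  have hsub : ∀ (f : M → V) (c : V) p (v : TangentSpace (𝓡 2) p),
      MDifferentiableAt (𝓡 2) 𝓘(ℝ, V) f p →
      MDifferentiableAt (𝓡 2) 𝓘(ℝ, V) (fun q => f q - c) p ∧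
      mvfderiv (𝓡 2) (fun q => f q - c) p v = mvfderiv (𝓡 2) f p v := by
    intro f c p v hf
    have hg : DifferentiableAt ℝ (fun x : V => x - c) (f p) := differentiableAt_id.sub_const c
    refine ⟨hg.mdifferentiableAt.comp p hf, ?_⟩
    have hg' : HasFDerivAt (fun x : V => x - c) (ContinuousLinearMap.id ℝ V) (f p) :=
      (hasFDerivAt_id (f p)).sub_const c
    rw [mvfderiv_comp_eq_fderiv hg hf, hg'.fderiv]
    rfl
  have h0 : ∀ p q, S.form (τ p - τ q) (S.position r p - S.position r q) = 0 := fun p q => by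
    rw [hτX, hτX]; exact form_sub_eq_zero_of_mem hsymm hX _ _
  intro p v w
  have h1 : ∀ q, S.form (mvfderiv (𝓡 2) τ p v) (S.position r p - S.position r q)
      + S.form (τ p - τ q) (mvfderiv (𝓡 2) (S.position r) p v) = 0 := by
    intro q
    have h2 := mvfderiv_bilinear S.form (hsub τ (τ q) p v (hτd p)).1
      (hsub (S.position r) (S.position r q) p v (hrd p)).1 v
    rw [(hsub τ (τ q) p v (hτd p)).2, (hsub (S.position r) (S.position r q) p v (hrd p)).2] at h2
    rw [← h2]
    simp only [h0]
    exact mvfderiv_const_apply _ _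
  set a := mvfderiv (𝓡 2) τ p v with ha
  set b := mvfderiv (𝓡 2) (S.position r) p v with hb
  have h3 := mvfderiv_clm_comp (S.form a) (hsub (S.position r) (S.position r p) p w (hrd p)).1 w
  rw [(hsub (S.position r) (S.position r p) p w (hrd p)).2] at h3
  have h5 : (fun q => S.form a (S.position r q - S.position r p)) =
      fun q => (-1 : ℝ) • (S.form.flip b) (τ q - τ p) := by
    funext q
    have := h1 q
    simp only [map_sub, sub_apply, ContinuousLinearMap.flip_apply, smul_eq_mul] at this ⊢
    linarith
  have h6 := mvfderiv_clm_comp ((-1 : ℝ) • S.form.flip b) (hsub τ (τ p) p w (hτd p)).1 w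
  rw [(hsub τ (τ p) p w (hτd p)).2] at h6
  rw [h5] at h3
  simp only [smul_apply] at h6
  rw [h6] at h3
  simp only [ContinuousLinearMap.flip_apply, smul_eq_mul] at h3
  rw [hsymm b, hsymm _ a]
  linarith

/-- Infinitesimal rigidity in a quadric, for a nondegenerate ambient form. -/
theorem isInfinitesimallyRigid_of_quadric [FiniteDimensional ℝ V] (hV : Module.finrank ℝ V = 4)
    [IsManifold (𝓡 2) ∞ M] [CompactSpace M] [ConnectedSpace M]
    (hsymm : ∀ x y, S.form x y = S.form y x) (hnd : ∀ x, S.form x = 0 → x = 0) {c : ℝ}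
    (hc : c ≠ 0) (hcar : ∀ x ∈ S.carrier, S.form x x = c)
    (htan : ∀ x, S.tangent x = LinearMap.ker (S.form x).toLinearMap)
    (hflow : ∀ A : V →L[ℝ] V, (∀ x y, S.form (A x) y + S.form x (A y) = 0) →
      ∀ t, ∀ x ∈ S.carrier, linearFlow A t x ∈ S.carrier)
    {r : M → S.carrier} (hr : S.IsConvexSurface r) : S.IsInfinitesimallyRigid r := by
  intro τ hτ
  refine ⟨fun hsol => ?_, fun ⟨X, hX, hτX⟩ =>
    solvesLinearized_of_mem hsymm hr.smooth hτ.smooth hX hτX⟩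
  obtain ⟨ν, hν, hpos⟩ := hr.convex
  have hd : ∀ {f : M → V}, ContMDiff (𝓡 2) 𝓘(ℝ, V) ∞ f → ∀ p,
      MDifferentiableAt (𝓡 2) 𝓘(ℝ, V) f p := fun hf p =>
    hf.contMDiffAt.mdifferentiableAt (by simp)
  have hT : ∀ x ∈ S.carrier, ∀ y ∈ S.tangent x, S.form y x = 0 := fun x _ y hy => by
    rw [htan] at hy
    rw [hsymm]
    exact hy
  have hform : ContMDiff 𝓘(ℝ, V) 𝓘(ℝ, V →L[ℝ] ℝ) ∞ S.form := S.form.contDiff.contMDiff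
  have hsurf : IsDeformedConvexSurface (S.position r) (fun p => S.form (τ p))
      (fun p => S.form (ν p)) := by
    refine ⟨hr.smooth, hform.comp hτ.smooth, hform.comp hν.smooth, fun p k v hkv => ?_,
      fun p => hT _ (r p).2 _ (hτ.tangent p), fun p v w => ?_,
      fun p => hT _ (r p).2 _ (hν.tangent p),
      hν.normal, fun p v hv => ?_⟩
    · have h1 : S.form (S.position r p) (mvfderiv (𝓡 2) (S.position r) p v) = 0 := by
        have h2 := mvfderiv_bilinear S.form (hd hr.smooth p) (hd hr.smooth p) v
        have h3 : (fun q => S.form (S.position r q) (S.position r q)) = fun _ => c :=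
          funext fun q => hcar _ (r q).2
        rw [h3, mvfderiv_const_apply, hsymm _ (S.position r p)] at h2
        linarith
      have h4 := congrArg (S.form (S.position r p)) hkv
      rw [map_add, map_smul, h1, show S.form (S.position r p) (S.position r p) = c from
        hcar _ (r p).2] at h4
      have hk : k = 0 := by simpa [hc] using h4
      refine ⟨hk, hr.immersion p ?_⟩
      rw [hk, zero_smul, zero_add] at hkv
      rw [hkv, map_zero]
    · rw [mvfderiv_clm_comp S.form (hd hτ.smooth p), mvfderiv_clm_comp S.form (hd hτ.smooth p),
        hsymm _ (mvfderiv (𝓡 2) (S.position r) p w), hsymm _ (mvfderiv (𝓡 2) (S.position r) p v),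
        add_comm]
      exact hsol p v w
    · rw [mvfderiv_clm_comp S.form (hd hν.smooth p)]
      exact hpos p v hv
  obtain ⟨Ω, hΩ, hΩr⟩ := hsurf.exists_isSkewForm hV
  obtain ⟨A, hA⟩ := exists_generator hnd Ω
  have hskew : ∀ x y, S.form (A x) y + S.form x (A y) = 0 := fun x y => by
    rw [hsymm x, hA, hA, hΩ x y]; ring
  refine ⟨fun x => A x, mem_isometryLieAlgebra_of_flow S (fun t x => linearFlow A t x)
    (hflow A hskew)
    (fun x _ => linearFlow_zero A x) (fun s t x _ => linearFlow_add A s t x)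
    (fun t x _ y _ => ?_) (fun x => ?_), fun p => ?_⟩
  · rw [← map_sub, linearFlow_invariant hskew]
  · simpa [linearFlow_zero] using hasDerivAt_linearFlow A x 0
  · have h1 : S.form (τ p - A (r p)) = 0 := by
      rw [map_sub, hA, sub_eq_zero]; exact (hΩr p).symm
    exact sub_eq_zero.1 (hnd _ h1)

end AmbientModel

theorem isInfinitesimallyRigid_spherical {M : Type*} [TopologicalSpace M]
    [ChartedSpace (EuclideanSpace ℝ (Fin 2)) M] [IsManifold (𝓡 2) ∞ M] [CompactSpace M]
    [ConnectedSpace M] {κ : ℝ} (hκ : 0 < κ) {r : M → (sphericalModel κ).carrier}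
    (hr : (sphericalModel κ).IsConvexSurface r) :
    (sphericalModel κ).IsInfinitesimallyRigid r := by
  have hsymm : ∀ x y, (sphericalModel κ).form x y = (sphericalModel κ).form y x :=
    fun x y => real_inner_comm y x
  refine AmbientModel.isInfinitesimallyRigid_of_quadric (c := 1 / κ) (by simp) hsymm
    (fun x hx => ?_) (by positivity) (fun x hx => hx) (fun x => rfl) (fun A hA t x hx => ?_) hr
  · have h1 : (sphericalModel κ).form x x = 0 := by rw [hx]; rfl
    exact inner_self_eq_zero.1 h1
  · exact (linearFlow_invariant hA x x t).trans hx

theorem isInfinitesimallyRigid_hyperbolic {M : Type*} [TopologicalSpace M]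
    [ChartedSpace (EuclideanSpace ℝ (Fin 2)) M] [IsManifold (𝓡 2) ∞ M] [CompactSpace M]
    [ConnectedSpace M] {κ : ℝ} (hκ : κ < 0) {r : M → (hyperbolicModel κ).carrier}
    (hr : (hyperbolicModel κ).IsConvexSurface r) :
    (hyperbolicModel κ).IsInfinitesimallyRigid r := by
  have hsymm : ∀ x y, (hyperbolicModel κ).form x y = (hyperbolicModel κ).form y x := by
    intro x y
    simp only [hyperbolicModel, minkowskiForm_apply]
    ring
  have hκ' : 1 / κ < 0 := one_div_neg.2 hκ
  refine AmbientModel.isInfinitesimallyRigid_of_quadric (c := 1 / κ) (by simp) hsymm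
    (fun x hx => ?_) hκ'.ne (fun x hx => hx.1) (fun x => rfl) (fun A hA t x hx => ?_) hr
  · have h1 : ∀ i : Fin 4, minkowskiForm x (EuclideanSpace.single i 1) = 0 := fun i => by
      have : (hyperbolicModel κ).form x (EuclideanSpace.single i 1) = 0 := by rw [hx]; rfl
      exact this
    simp only [minkowskiForm_apply] at h1
    ext i
    have h2 := h1 i
    fin_cases i <;> simpa using h2
  · have hinv : ∀ s, minkowskiForm (linearFlow A s x) (linearFlow A s x) = 1 / κ := fun s =>
      (linearFlow_invariant hA x x s).trans hx.1
    refine ⟨hinv t, ?_⟩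
    by_contra! hneg
    have hcont : Continuous fun s => linearFlow A s x 0 :=
      (EuclideanSpace.proj (𝕜 := ℝ) (0 : Fin 4)).continuous.comp
        (continuous_iff_continuousAt.2 fun s => (hasDerivAt_linearFlow A x s).continuousAt)
    obtain ⟨s, hs⟩ := mem_range_of_exists_le_of_exists_ge hcont ⟨t, hneg⟩
      ⟨0, by rw [linearFlow_zero]; exact hx.2.le⟩
    have h1 := hinv s
    rw [minkowskiForm_apply] at h1
    simp only at hs
    rw [hs] at h1
    nlinarith [mul_self_nonneg (linearFlow A s x 1), mul_self_nonneg (linearFlow A s x 2),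
      mul_self_nonneg (linearFlow A s x 3)]

section Euclidean

/-- Euclidean three-space. -/
local notation "ℝ³" => EuclideanSpace ℝ (Fin 3)

/-- The covector `(c, w) ↦ ⟪y, w - c x⟫` on the cone over Euclidean three-space that corresponds to
the tangent vector `y` at the point `x`. -/
noncomputable def coneCovector (x y : ℝ³) : (ℝ × ℝ³) →L[ℝ] ℝ :=
  (innerSL ℝ y).comp (ContinuousLinearMap.snd ℝ ℝ ℝ³)
    - ⟪y, x⟫ • ContinuousLinearMap.fst ℝ ℝ ℝ³

theorem coneCovector_apply (x y : ℝ³) (z : ℝ × ℝ³) :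
    coneCovector x y z = ⟪y, z.2 - z.1 • x⟫ := by
  simp [coneCovector, inner_sub_right, inner_smul_right, mul_comm]

theorem contDiff_coneCovector :
    ContDiff ℝ ∞ (fun q : ℝ³ × ℝ³ => coneCovector q.1 q.2) := by
  unfold coneCovector
  exact (((innerSL ℝ (E := ℝ³)).contDiff.comp contDiff_snd).clm_comp contDiff_const).sub
    ((contDiff_snd.inner ℝ contDiff_fst).smul contDiff_const)

variable {M : Type*} [TopologicalSpace M] [ChartedSpace (EuclideanSpace ℝ (Fin 2)) M]
  {r f : M → ℝ³} (hr : ContMDiff (𝓡 2) 𝓘(ℝ, ℝ³) ∞ r) (hf : ContMDiff (𝓡 2) 𝓘(ℝ, ℝ³) ∞ f)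

include hr

theorem contMDiff_cone : ContMDiff (𝓡 2) 𝓘(ℝ, ℝ × ℝ³) ∞ (fun p => ((1 : ℝ), r p)) :=
  contMDiff_const.prodMk_space hr

theorem mvfderiv_cone (p : M) (v : TangentSpace (𝓡 2) p) :
    mvfderiv (𝓡 2) (fun p => ((1 : ℝ), r p)) p v = (0, mvfderiv (𝓡 2) r p v) := by
  have h := hasFDerivAt_prodMk_right (𝕜 := ℝ) (1 : ℝ) (r p)
  rw [mvfderiv_comp_eq_fderiv h.differentiableAt (hr.contMDiffAt.mdifferentiableAt (by simp)),
    h.fderiv]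
  rfl

include hf

theorem contMDiff_coneCovector :
    ContMDiff (𝓡 2) 𝓘(ℝ, (ℝ × ℝ³) →L[ℝ] ℝ) ∞ (fun p => coneCovector (r p) (f p)) :=
  ContDiff.comp_contMDiff (g := fun q : ℝ³ × ℝ³ => coneCovector q.1 q.2)
    (f := fun p => (r p, f p)) contDiff_coneCovector (hr.prodMk_space hf)

theorem mvfderiv_coneCovector (p : M) (v : TangentSpace (𝓡 2) p) (w : ℝ³) :
    mvfderiv (𝓡 2) (fun p => coneCovector (r p) (f p)) p v (0, w) =
      ⟪mvfderiv (𝓡 2) f p v, w⟫ := by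
  rw [mvfderiv_apply_const
    ((contMDiff_coneCovector hr hf).contMDiffAt.mdifferentiableAt (by simp))]
  simp only [coneCovector_apply, zero_smul, sub_zero]
  have h := mvfderiv_clm_comp ((innerSL ℝ (E := ℝ³)).flip w)
    (hf.contMDiffAt.mdifferentiableAt (x := p) (by simp)) v
  exact h

end Euclidean

/-- Infinitesimal rigidity in Euclidean three-space. -/
theorem isInfinitesimallyRigid_euclidean {M : Type*} [TopologicalSpace M]
    [ChartedSpace (EuclideanSpace ℝ (Fin 2)) M] [IsManifold (𝓡 2) ∞ M] [CompactSpace M]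
    [ConnectedSpace M] {r : M → euclideanModel.carrier}
    (hr : euclideanModel.IsConvexSurface r) : euclideanModel.IsInfinitesimallyRigid r := by
  have hsymm : ∀ x y, euclideanModel.form x y = euclideanModel.form y x :=
    fun x y => real_inner_comm y x
  intro τ hτ
  refine ⟨fun hsol => ?_, fun ⟨X, hX, hτX⟩ =>
    AmbientModel.solvesLinearized_of_mem hsymm hr.smooth hτ.smooth hX hτX⟩
  obtain ⟨ν, hν, hpos⟩ := hr.convex
  set ρ := euclideanModel.position r with hρ
  have hρs := hr.smooth
  rw [← hρ] at hρs
  have hsurf : IsDeformedConvexSurface (fun p => ((1 : ℝ), ρ p))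
      (fun p => coneCovector (ρ p) (τ p)) (fun p => coneCovector (ρ p) (ν p)) := by
    refine ⟨contMDiff_cone hρs, contMDiff_coneCovector hρs hτ.smooth,
      contMDiff_coneCovector hρs hν.smooth, fun p c v h => ?_, fun p => ?_, fun p v w => ?_,
      fun p => ?_, fun p v => ?_, fun p v hv => ?_⟩
    · rw [mvfderiv_cone hρs, Prod.ext_iff] at h
      obtain ⟨h1, h2⟩ := h
      have hc : c = 0 := by simpa using h1
      subst hc
      refine ⟨rfl, hr.immersion p ?_⟩
      rw [map_zero]
      simpa using h2
    · simp [coneCovector_apply]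
    · simp only [mvfderiv_cone hρs, mvfderiv_coneCovector hρs hτ.smooth]
      have h1 := hsol p w v
      have h2 := hsymm (mvfderiv (𝓡 2) ρ p w) (mvfderiv (𝓡 2) τ p v)
      have h3 := hsymm (mvfderiv (𝓡 2) ρ p v) (mvfderiv (𝓡 2) τ p w)
      rw [← hρ, h2, h3] at h1
      exact h1
    · simp [coneCovector_apply]
    · rw [mvfderiv_cone hρs, coneCovector_apply]
      simp only [zero_smul, sub_zero]
      exact hν.normal p v
    · rw [mvfderiv_cone hρs, mvfderiv_coneCovector hρs hν.smooth]
      exact hpos p v hv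
  obtain ⟨Ω, hΩ, hΩr⟩ := hsurf.exists_isSkewForm (by simp)
  have hnd : ∀ x, euclideanModel.form x = 0 → x = 0 := fun x hx => by
    have h1 : euclideanModel.form x x = 0 := by rw [hx]; rfl
    exact inner_self_eq_zero.1 h1
  obtain ⟨C, hC⟩ := exists_generator hnd
    (((ContinuousLinearMap.compL ℝ (EuclideanSpace ℝ (Fin 3)) (ℝ × EuclideanSpace ℝ (Fin 3))
      ℝ).flip (ContinuousLinearMap.inr ℝ ℝ (EuclideanSpace ℝ (Fin 3)))).comp Ω)
  have hCΩ : ∀ z y, ⟪C z, y⟫ = Ω z (0, y) := fun z y => congrArg (fun L => L y) (hC z)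
  set A := (ContinuousLinearMap.inr ℝ ℝ (EuclideanSpace ℝ (Fin 3))).comp C with hA
  have hd1 : ∀ z t, HasDerivAt (fun t => (linearFlow A t z).1) 0 t := fun z t =>
    (ContinuousLinearMap.fst ℝ ℝ (EuclideanSpace ℝ (Fin 3))).hasFDerivAt.comp_hasDerivAt t
      (hasDerivAt_linearFlow A z t)
  have hd2 : ∀ z t, HasDerivAt (fun t => (linearFlow A t z).2) (C (linearFlow A t z)) t :=
    fun z t => (ContinuousLinearMap.snd ℝ ℝ (EuclideanSpace ℝ (Fin 3))).hasFDerivAt.comp_hasDerivAt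
      t (hasDerivAt_linearFlow A z t)
  have hfst : ∀ z t, (linearFlow A t z).1 = z.1 := fun z t => by
    have h := is_const_of_deriv_eq_zero (fun t => (hd1 z t).differentiableAt)
      (fun t => (hd1 z t).deriv) t 0
    rwa [linearFlow_zero] at h
  have hnorm : ∀ (x : EuclideanSpace ℝ (Fin 3)) t,
      ⟪(linearFlow A t (0, x)).2, (linearFlow A t (0, x)).2⟫ = ⟪x, x⟫ := fun x t => by
    have h : ∀ t, HasDerivAt
        (fun t => ⟪(linearFlow A t (0, x)).2, (linearFlow A t (0, x)).2⟫) 0 t := by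
      intro t
      refine ((hd2 (0, x) t).inner ℝ (hd2 (0, x) t)).congr_deriv ?_
      have h1 : ((0 : ℝ), (linearFlow A t (0, x)).2) = linearFlow A t (0, x) :=
        Prod.ext (hfst (0, x) t).symm rfl
      rw [real_inner_comm, hCΩ, h1]
      linarith [hΩ (linearFlow A t (0, x)) (linearFlow A t (0, x))]
    have h2 := is_const_of_deriv_eq_zero (fun t => (h t).differentiableAt)
      (fun t => (h t).deriv) t 0
    rwa [linearFlow_zero] at h2
  have hone : ∀ x t, ((1 : ℝ), (linearFlow A t (1, x)).2) = linearFlow A t (1, x) := fun x t =>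
    Prod.ext (hfst (1, x) t).symm rfl
  refine ⟨fun x => C (1, x), AmbientModel.mem_isometryLieAlgebra_of_flow _
    (fun t x => (linearFlow A t (1, x)).2) (fun _ _ _ => Set.mem_univ _)
    (fun x _ => by simp [linearFlow_zero]) (fun s t x _ => ?_) (fun t x _ y _ => ?_) (fun x => ?_),
    fun p => ?_⟩
  · rw [hone, linearFlow_add]
  · have h1 : (linearFlow A t (1, x)).2 - (linearFlow A t (1, y)).2 =
        (linearFlow A t (0, x - y)).2 := by
      rw [← Prod.snd_sub, ← map_sub]
      simp
    rw [h1]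
    exact hnorm (x - y) t
  · simpa [linearFlow_zero] using hd2 (1, (x : EuclideanSpace ℝ (Fin 3))) 0
  · refine ext_inner_right ℝ fun y => ?_
    rw [hCΩ]
    have h1 := congrArg (fun L => L ((0 : ℝ), y)) (hΩr p)
    simp only [coneCovector_apply, zero_smul, sub_zero] at h1
    exact h1.symm

theorem mainTheorem3 {M : Type*} [TopologicalSpace M] [T2Space M] [CompactSpace M]
    [ConnectedSpace M] [ChartedSpace (EuclideanSpace ℝ (Fin 2)) M] [IsManifold (𝓡 2) ∞ M] :
    (∀ r : M → euclideanModel.carrier,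
      euclideanModel.IsConvexSurface r → euclideanModel.IsInfinitesimallyRigid r) ∧
    (∀ κ : ℝ, 0 < κ → ∀ r : M → (sphericalModel κ).carrier,
      (sphericalModel κ).IsConvexSurface r → (sphericalModel κ).IsInfinitesimallyRigid r) ∧
    (∀ κ : ℝ, κ < 0 → ∀ r : M → (hyperbolicModel κ).carrier,
      (hyperbolicModel κ).IsConvexSurface r → (hyperbolicModel κ).IsInfinitesimallyRigid r) :=
  ⟨fun _ hr => isInfinitesimallyRigid_euclidean hr,
    fun _ hκ _ hr => isInfinitesimallyRigid_spherical hκ hr,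
    fun _ hκ _ hr => isInfinitesimallyRigid_hyperbolic hκ hr⟩
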